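/- **Conventions.** All compositions are written in diagrammatic order. In an $n$-globular set, $u,v$ are $i$-composable when the $i$-target of $u$ is the $i$-source of $v$. A *3-precategory* $C$ is a 3-globular set with identities $\mathrm{id}\colon C_{k-1}\to C_k$ ($1\le k\le 3$) and compositions $C_k\times_i C_l\to C_{\max(k,l)}$, $(u,v)\mapsto u\circ_i v$, $i=\min(k,l)-1$, $1\le k,l\le 3$, such that: * identities have the prescribed sources and targets; $\partial^{\pm}(u\circ_i v)$ is $u\circ_i\partial^{\pm}v$ if $k<l$, is $\partial^{\pm}u\circ_i v$ if $k>l$, and if $k=l$ the source is that of $u$ and the target is that of $v$; * for $u\in C_{k-1}$, $v\in C_l$: $\mathrm{id}_u\circ_i v=v$ if $k\le l$ and $=\mathrm{id}_{u\circ_i v}$ if $k>l$; symmetrically on the right; * $(u\circ_i v)\circ_i w=u\circ_i(v\circ_i w)$ whenever these composites are defined; * for $i<j$ and $u\in C_{i+1}$: $u\circ_i(v\circ_j v')=(u\circ_i v)\circ_j(u\circ_i v')$, and for $v\in C_{i+1}$: $(u\circ_j u')\circ_i v=(u\circ_i v)\circ_j(u'\circ_i v)$, whenever these composites are defined. No interchange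 law is required. A *lax Gray category* is a 3-precategory $C$ together with, for every 0-composable pair of 2-cells $\phi\colon f\Rightarrow f'$, $\psi\colon g\Rightarrow g'$, a 3-cell, called interchanger, $$X_{\phi,\psi}\colon(\phi\circ_0 g)\circ_1(f'\circ_0\psi)\Rrightarrow(f\circ_0\psi)\circ_1(\phi\circ_0 g')$$ such that the following hold. 1. *(Interchanger axioms.)* For $\phi\colon f\Rightarrow f'$, $\phi'\colon f'\Rightarrow f''$, $\psi\colon g\Rightarrow g'$, $\psi'\colon g'\Rightarrow g''$ and 1-cells $e,h,k$, whenever the expressions are defined, $$X_{\mathrm{id}_f,\psi}=\mathrm{id}_{f\circ_0\psi},\qquad X_{\phi,\mathrm{id}_g}=\mathrm{id}_{\phi\circ_0 g},$$ $$X_{\phi\circ_1\phi',\psi}=((\phi\circ_0 g)\circ_1X_{\phi',\psi})\circ_2(X_{\phi,\psi}\circ_1(\phi'\circ_0 g')),$$ $$X_{\phi,\psi\circ_1\psi'}=(X_{\phi,\psi}\circ_1(f'\circ_0\psi'))\circ_2((f\circ_0\psi)\circ_1X_{\phi,\psi'}),$$ $$X_{e\circ_0\phi,\psi}=e\circ_0X_{\phi,\psi},\qquad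 X_{\phi,\psi\circ_0h}=X_{\phi,\psi}\circ_0h,\qquad X_{\phi\circ_0k,\psi}=X_{\phi,k\circ_0\psi}.$$ 2. *(Exchange law for 3-cells.)* For 1-composable 3-cells $A\colon\phi\Rrightarrow\phi'$ and $B\colon\psi\Rrightarrow\psi'$, $$(A\circ_1\psi)\circ_2(\phi'\circ_1B)=(\phi\circ_1B)\circ_2(A\circ_1\psi').$$ 3. *(Naturality of interchangers.)* For 0-composable $A\colon\phi\Rrightarrow\phi'\colon u\Rightarrow u'$ and $\psi\colon v\Rightarrow v'$, $$((A\circ_0v)\circ_1(u'\circ_0\psi))\circ_2X_{\phi',\psi}=X_{\phi,\psi}\circ_2((u\circ_0\psi)\circ_1(A\circ_0v')),$$ and for 0-composable $\phi\colon u\Rightarrow u'$ and $B\colon\psi\Rrightarrow\psi'\colon v\Rightarrow v'$, $$((\phi\circ_0v)\circ_1(u'\circ_0B))\circ_2X_{\phi,\psi'}=X_{\phi,\psi}\circ_2((u\circ_0B)\circ_1(\phi\circ_0v')).$$ A *4-prepolygraph* $P$ consists of sets $P_0,\dots,P_4$ of generators where each element of $P_{k+1}$ has a source and a target which are parallel $k$-cells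 of the 3-precategory $P^*$ freely generated by $P_0,\dots,P_3$ (for $k=0$: any two elements of $P_0$). Explicitly, the 0-cells of $P^*$ are the elements of $P_0$, its 1-cells are the composable sequences of elements of $P_1$, its 2-cells are the 1-composable sequences of whiskers $f\circ_0\alpha\circ_0g$ with $\alpha\in P_2$ and $f,g\in P_1^*$, and its 3-cells are the 2-composable sequences of whiskers $\lambda\circ_1(f\circ_0A\circ_0g)\circ_1\rho$ with $A\in P_3$, $f,g\in P_1^*$ and $\lambda,\rho\in P_2^*$. The *presented 3-precategory* $\overline P$ is the quotient of $P^*$ by the smallest congruence on 3-cells which identifies the source and the target of each element of $P_4$. A *Gray presentation* is a 4-prepolygraph $P$ containing the following distinguished generators (and possibly others). * For all $\alpha\colon f\Rightarrow f'$ and $\beta\colon h\Rightarrow h'$ in $P_2$ and $g\in P_1^*$ with $\alpha,g,\beta$ 0-composable, a 3-generator $$X_{\alpha,g,\beta}\colon(\alpha\circ_0g\circ_0h)\circ_1(f'\circ_0g\circ_0\beta)\Rrightarrow(f\circ_0g\circ_0\beta)\circ_1(\alpha\circ_0g\circ_0h').$$ * For all $A\colon\phi\Rrightarrow\phi'\colon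 f\Rightarrow g$ and $B\colon\psi\Rrightarrow\psi'\colon f'\Rightarrow g'$ in $P_3$, $e,h,e',h'\in P_1^*$ and $\chi\colon e\circ_0g\circ_0h\Rightarrow e'\circ_0f'\circ_0h'$ in $P_2^*$, a 4-generator from $$\big((e\circ_0A\circ_0h)\circ_1\chi\circ_1(e'\circ_0\psi\circ_0h')\big)\circ_2\big((e\circ_0\phi'\circ_0h)\circ_1\chi\circ_1(e'\circ_0B\circ_0h')\big)$$ to $$\big((e\circ_0\phi\circ_0h)\circ_1\chi\circ_1(e'\circ_0B\circ_0h')\big)\circ_2\big((e\circ_0A\circ_0h)\circ_1\chi\circ_1(e'\circ_0\psi'\circ_0h')\big).$$ * For all 0-composable $A\colon\phi\Rrightarrow\phi'\colon f\Rightarrow f'$ in $P_3$, $g\in P_1^*$ and $\beta\colon h\Rightarrow h'$ in $P_2$, a 4-generator from $((A\circ_0g\circ_0h)\circ_1(f'\circ_0g\circ_0\beta))\circ_2X_{\phi',g\circ_0\beta}$ to $X_{\phi,g\circ_0\beta}\circ_2((f\circ_0g\circ_0\beta)\circ_1(A\circ_0g\circ_0h'))$. * For all 0-composable $\alpha\colon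 f\Rightarrow f'$ in $P_2$, $g\in P_1^*$ and $B\colon\psi\Rrightarrow\psi'\colon h\Rightarrow h'$ in $P_3$, a 4-generator from $((\alpha\circ_0g\circ_0h)\circ_1(f'\circ_0g\circ_0B))\circ_2X_{\alpha\circ_0g,\psi'}$ to $X_{\alpha\circ_0g,\psi}\circ_2((f\circ_0g\circ_0B)\circ_1(\alpha\circ_0g\circ_0h'))$. Here, for 0-composable 2-cells $\phi=\phi_1\circ_1\cdots\circ_1\phi_k$ and $\psi=\psi_1\circ_1\cdots\circ_1\psi_m$ of $P^*$ written as sequences of whiskers $\phi_p=f_p\circ_0\alpha_p\circ_0g_p$ and $\psi_q=f'_q\circ_0\beta_q\circ_0g'_q$, the 3-cell $X_{\phi,\psi}$ of $P^*$, from $(\phi\circ_0\partial^-\psi)\circ_1(\partial^+\phi\circ_0\psi)$ to $(\partial^-\phi\circ_0\psi)\circ_1(\phi\circ_0\partial^+\psi)$, is the $\circ_2$-composite of $km$ elementary exchanges which first move $\phi_k$ past $\psi_1$, then past $\psi_2$, ..., then past $\psi_m$, then in the same way $\phi_{k-1}$, ..., and finally $\phi_1$. The elementary exchange of $\phi_p$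 with $\psi_q$ is the 3-cell $f_p\circ_0X_{\alpha_p,\,g_p\circ_0f'_q,\,\beta_q}\circ_0g'_q$, composed by $\circ_1$ on the left with $\phi_1,\dots,\phi_{p-1},\psi_1,\dots,\psi_{q-1}$ in this order and on the right with $\psi_{q+1},\dots,\psi_m,\phi_{p+1},\dots,\phi_k$ in this order (each suitably whiskered by $\circ_0$). If $k=0$ or $m=0$, it is an identity. **Theorem.** For every Gray presentation $P$, the presented 3-precategory $\overline P$, equipped with the classes of the 3-cells $X_{\phi,\psi}$ as interchangers, is a lax Gray category: it satisfies the interchanger axioms (1), the exchange law for 3-cells (2) and the naturality of interchangers (3). -/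

import Mathlib

universe u

namespace GrayRewriting

/-! ### 3-precategories -/

/-- A 3-globular set with identities `id_k : C_{k-1} → C_k` and compositions
`c_{kl} : C_k ×_i C_l → C_{max(k,l)}`, `i = min(k,l) - 1`, whose sources and targets are as
prescribed.  The iterated sources and targets of a cell of dimension at least two are written
through its immediate source: `t0 (s1 φ)` is the 0-target of `φ`. -/
structure PrecategoryData3 where
  C0 : Type u
  C1 : Type u
  C2 : Type u
  C3 : Type u
  s0 : C1 → C0
  t0 : C1 → C0
  s1 : C2 → C1
  t1 : C2 → C1
  s2 : C3 → C2
  t2 : C3 → C2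
  s0_t1 : ∀ φ, s0 (t1 φ) = s0 (s1 φ)
  t0_t1 : ∀ φ, t0 (t1 φ) = t0 (s1 φ)
  s1_t2 : ∀ F, s1 (t2 F) = s1 (s2 F)
  t1_t2 : ∀ F, t1 (t2 F) = t1 (s2 F)
  id1 : C0 → C1
  id2 : C1 → C2
  id3 : C2 → C3
  c11 : ∀ f g : C1, (h : t0 f = s0 g := by first | assumption | (simp [*]; done) | grind) → C1
  c12 : ∀ (f : C1) (φ : C2), (h : t0 f = s0 (s1 φ) := by first | assumption | (simp [*]; done) | grind) → C2
  c21 : ∀ (φ : C2) (f : C1), (h : t0 (s1 φ) = s0 f := by first | assumption | (simp [*]; done) | grind) → C2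
  c13 : ∀ (f : C1) (F : C3), (h : t0 f = s0 (s1 (s2 F)) := by first | assumption | (simp [*]; done) | grind) → C3
  c31 : ∀ (F : C3) (f : C1), (h : t0 (s1 (s2 F)) = s0 f := by first | assumption | (simp [*]; done) | grind) → C3
  c22 : ∀ φ ψ : C2, (h : t1 φ = s1 ψ := by first | assumption | (simp [*]; done) | grind) → C2
  c23 : ∀ (φ : C2) (F : C3), (h : t1 φ = s1 (s2 F) := by first | assumption | (simp [*]; done) | grind) → C3
  c32 : ∀ (F : C3) (φ : C2), (h : t1 (s2 F) = s1 φ := by first | assumption | (simp [*]; done) | grind) → C3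
  c33 : ∀ F G : C3, (h : t2 F = s2 G := by first | assumption | (simp [*]; done) | grind) → C3
  s0_id1 : ∀ x, s0 (id1 x) = x
  t0_id1 : ∀ x, t0 (id1 x) = x
  s1_id2 : ∀ f, s1 (id2 f) = f
  t1_id2 : ∀ f, t1 (id2 f) = f
  s2_id3 : ∀ φ, s2 (id3 φ) = φ
  t2_id3 : ∀ φ, t2 (id3 φ) = φ
  s0_c11 : ∀ f g h, s0 (c11 f g h) = s0 f
  t0_c11 : ∀ f g h, t0 (c11 f g h) = t0 g
  s1_c12 : ∀ f φ h, s1 (c12 f φ h) = c11 f (s1 φ) h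
  t1_c12 : ∀ f φ h, t1 (c12 f φ h) = c11 f (t1 φ) (h.trans (s0_t1 φ).symm)
  s1_c21 : ∀ φ f h, s1 (c21 φ f h) = c11 (s1 φ) f h
  t1_c21 : ∀ φ f h, t1 (c21 φ f h) = c11 (t1 φ) f ((t0_t1 φ).trans h)
  s2_c13 : ∀ f F h, s2 (c13 f F h) = c12 f (s2 F) h
  t2_c13 : ∀ f F h, t2 (c13 f F h) = c12 f (t2 F) (h.trans (congrArg s0 (s1_t2 F).symm))
  s2_c31 : ∀ F f h, s2 (c31 F f h) = c21 (s2 F) f h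
  t2_c31 : ∀ F f h, t2 (c31 F f h) = c21 (t2 F) f ((congrArg t0 (s1_t2 F)).trans h)
  s1_c22 : ∀ φ ψ h, s1 (c22 φ ψ h) = s1 φ
  t1_c22 : ∀ φ ψ h, t1 (c22 φ ψ h) = t1 ψ
  s2_c23 : ∀ φ F h, s2 (c23 φ F h) = c22 φ (s2 F) h
  t2_c23 : ∀ φ F h, t2 (c23 φ F h) = c22 φ (t2 F) (h.trans (s1_t2 F).symm)
  s2_c32 : ∀ F φ h, s2 (c32 F φ h) = c22 (s2 F) φ h
  t2_c32 : ∀ F φ h, t2 (c32 F φ h) = c22 (t2 F) φ ((t1_t2 F).trans h)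
  s2_c33 : ∀ F G h, s2 (c33 F G h) = s2 F
  t2_c33 : ∀ F G h, t2 (c33 F G h) = t2 G

attribute [simp, grind =] PrecategoryData3.s0_t1 PrecategoryData3.t0_t1 PrecategoryData3.s1_t2
  PrecategoryData3.t1_t2 PrecategoryData3.s0_id1 PrecategoryData3.t0_id1 PrecategoryData3.s1_id2
  PrecategoryData3.t1_id2 PrecategoryData3.s2_id3 PrecategoryData3.t2_id3 PrecategoryData3.s0_c11
  PrecategoryData3.t0_c11 PrecategoryData3.s1_c12 PrecategoryData3.t1_c12 PrecategoryData3.s1_c21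
  PrecategoryData3.t1_c21 PrecategoryData3.s2_c13 PrecategoryData3.t2_c13 PrecategoryData3.s2_c31
  PrecategoryData3.t2_c31 PrecategoryData3.s1_c22 PrecategoryData3.t1_c22 PrecategoryData3.s2_c23
  PrecategoryData3.t2_c23 PrecategoryData3.s2_c32 PrecategoryData3.t2_c32 PrecategoryData3.s2_c33
  PrecategoryData3.t2_c33

/-- Unit laws of a 3-precategory: `id u ∘ v = v` and `u ∘ id v = u` when the identity has the
lower or the same dimension, and whiskering an identity gives an identity otherwise. -/
structure UnitLaws (C : PrecategoryData3.{u}) : Prop where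
  -- units on the left
  id_c11 : ∀ f, C.c11 (C.id1 (C.s0 f)) f = f
  id_c12 : ∀ φ, C.c12 (C.id1 (C.s0 (C.s1 φ))) φ = φ
  id_c13 : ∀ F, C.c13 (C.id1 (C.s0 (C.s1 (C.s2 F)))) F = F
  id_c22 : ∀ φ, C.c22 (C.id2 (C.s1 φ)) φ = φ
  id_c23 : ∀ F, C.c23 (C.id2 (C.s1 (C.s2 F))) F = F
  id_c33 : ∀ F, C.c33 (C.id3 (C.s2 F)) F = F
  id_c21 : ∀ (f g : C.C1) (h : C.t0 f = C.s0 g), C.c21 (C.id2 f) g = C.id2 (C.c11 f g)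
  id_c31 : ∀ (φ : C.C2) (g : C.C1) (h : C.t0 (C.s1 φ) = C.s0 g), C.c31 (C.id3 φ) g = C.id3 (C.c21 φ g)
  id_c32 : ∀ (φ ψ : C.C2) (h : C.t1 φ = C.s1 ψ), C.c32 (C.id3 φ) ψ = C.id3 (C.c22 φ ψ)
  -- units on the right
  c11_id : ∀ f, C.c11 f (C.id1 (C.t0 f)) = f
  c21_id : ∀ φ, C.c21 φ (C.id1 (C.t0 (C.s1 φ))) = φ
  c31_id : ∀ F, C.c31 F (C.id1 (C.t0 (C.s1 (C.s2 F)))) = F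
  c22_id : ∀ φ, C.c22 φ (C.id2 (C.t1 φ)) = φ
  c32_id : ∀ F, C.c32 F (C.id2 (C.t1 (C.s2 F))) = F
  c33_id : ∀ F, C.c33 F (C.id3 (C.t2 F)) = F
  c12_id : ∀ (f g : C.C1) (h : C.t0 f = C.s0 g), C.c12 f (C.id2 g) = C.id2 (C.c11 f g)
  c13_id : ∀ (f : C.C1) (φ : C.C2) (h : C.t0 f = C.s0 (C.s1 φ)), C.c13 f (C.id3 φ) = C.id3 (C.c12 f φ)
  c23_id : ∀ (φ ψ : C.C2) (h : C.t1 φ = C.s1 ψ), C.c23 φ (C.id3 ψ) = C.id3 (C.c22 φ ψ)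

/-- Associativity laws of a 3-precategory. -/
structure AssocLaws (C : PrecategoryData3.{u}) : Prop where
  -- associativity of the 0-compositions
  assoc111 : ∀ (f g k : C.C1) (h : C.t0 f = C.s0 g) (h' : C.t0 g = C.s0 k),
    C.c11 (C.c11 f g) k = C.c11 f (C.c11 g k)
  assoc112 : ∀ (f g : C.C1) (φ : C.C2) (h : C.t0 f = C.s0 g) (h' : C.t0 g = C.s0 (C.s1 φ)),
    C.c12 (C.c11 f g) φ = C.c12 f (C.c12 g φ)
  assoc121 : ∀ (f : C.C1) (φ : C.C2) (g : C.C1) (h : C.t0 f = C.s0 (C.s1 φ)) (h' : C.t0 (C.s1 φ) = C.s0 g),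
    C.c21 (C.c12 f φ) g = C.c12 f (C.c21 φ g)
  assoc211 : ∀ (φ : C.C2) (f g : C.C1) (h : C.t0 (C.s1 φ) = C.s0 f) (h' : C.t0 f = C.s0 g),
    C.c21 (C.c21 φ f) g = C.c21 φ (C.c11 f g)
  assoc113 : ∀ (f g : C.C1) (F : C.C3) (h : C.t0 f = C.s0 g) (h' : C.t0 g = C.s0 (C.s1 (C.s2 F))),
    C.c13 (C.c11 f g) F = C.c13 f (C.c13 g F)
  assoc131 : ∀ (f : C.C1) (F : C.C3) (g : C.C1) (h : C.t0 f = C.s0 (C.s1 (C.s2 F)))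
    (h' : C.t0 (C.s1 (C.s2 F)) = C.s0 g), C.c31 (C.c13 f F) g = C.c13 f (C.c31 F g)
  assoc311 : ∀ (F : C.C3) (f g : C.C1) (h : C.t0 (C.s1 (C.s2 F)) = C.s0 f) (h' : C.t0 f = C.s0 g),
    C.c31 (C.c31 F f) g = C.c31 F (C.c11 f g)
  -- associativity of the 1-compositions
  assoc222 : ∀ (φ ψ χ : C.C2) (h : C.t1 φ = C.s1 ψ) (h' : C.t1 ψ = C.s1 χ),
    C.c22 (C.c22 φ ψ) χ = C.c22 φ (C.c22 ψ χ)
  assoc223 : ∀ (φ ψ : C.C2) (F : C.C3) (h : C.t1 φ = C.s1 ψ) (h' : C.t1 ψ = C.s1 (C.s2 F)),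
    C.c23 (C.c22 φ ψ) F = C.c23 φ (C.c23 ψ F)
  assoc232 : ∀ (φ : C.C2) (F : C.C3) (ψ : C.C2) (h : C.t1 φ = C.s1 (C.s2 F)) (h' : C.t1 (C.s2 F) = C.s1 ψ),
    C.c32 (C.c23 φ F) ψ = C.c23 φ (C.c32 F ψ)
  assoc322 : ∀ (F : C.C3) (φ ψ : C.C2) (h : C.t1 (C.s2 F) = C.s1 φ) (h' : C.t1 φ = C.s1 ψ),
    C.c32 (C.c32 F φ) ψ = C.c32 F (C.c22 φ ψ)
  -- associativity of the 2-composition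
  assoc333 : ∀ (F G H : C.C3) (h : C.t2 F = C.s2 G) (h' : C.t2 G = C.s2 H),
    C.c33 (C.c33 F G) H = C.c33 F (C.c33 G H)

/-- Distributivity of the `i`-compositions with an `(i+1)`-cell over the higher compositions. -/
structure DistribLaws (C : PrecategoryData3.{u}) : Prop where
  -- distributivity on the left
  distrib1_22 : ∀ (f : C.C1) (φ ψ : C.C2) (h : C.t0 f = C.s0 (C.s1 φ)) (h' : C.t1 φ = C.s1 ψ),
    C.c12 f (C.c22 φ ψ) = C.c22 (C.c12 f φ) (C.c12 f ψ)
  distrib1_23 : ∀ (f : C.C1) (φ : C.C2) (F : C.C3) (h : C.t0 f = C.s0 (C.s1 φ)) (h' : C.t1 φ = C.s1 (C.s2 F)),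
    C.c13 f (C.c23 φ F) = C.c23 (C.c12 f φ) (C.c13 f F)
  distrib1_32 : ∀ (f : C.C1) (F : C.C3) (φ : C.C2) (h : C.t0 f = C.s0 (C.s1 (C.s2 F)))
    (h' : C.t1 (C.s2 F) = C.s1 φ), C.c13 f (C.c32 F φ) = C.c32 (C.c13 f F) (C.c12 f φ)
  distrib1_33 : ∀ (f : C.C1) (F G : C.C3) (h : C.t0 f = C.s0 (C.s1 (C.s2 F))) (h' : C.t2 F = C.s2 G),
    C.c13 f (C.c33 F G) = C.c33 (C.c13 f F) (C.c13 f G)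
  distrib2_33 : ∀ (φ : C.C2) (F G : C.C3) (h : C.t1 φ = C.s1 (C.s2 F)) (h' : C.t2 F = C.s2 G),
    C.c23 φ (C.c33 F G) = C.c33 (C.c23 φ F) (C.c23 φ G)
  -- distributivity on the right
  distrib22_1 : ∀ (φ ψ : C.C2) (f : C.C1) (h : C.t0 (C.s1 φ) = C.s0 f) (h' : C.t1 φ = C.s1 ψ),
    C.c21 (C.c22 φ ψ) f = C.c22 (C.c21 φ f) (C.c21 ψ f)
  distrib23_1 : ∀ (φ : C.C2) (F : C.C3) (f : C.C1) (h : C.t0 (C.s1 φ) = C.s0 f) (h' : C.t1 φ = C.s1 (C.s2 F)),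
    C.c31 (C.c23 φ F) f = C.c23 (C.c21 φ f) (C.c31 F f)
  distrib32_1 : ∀ (F : C.C3) (φ : C.C2) (f : C.C1) (h : C.t0 (C.s1 (C.s2 F)) = C.s0 f)
    (h' : C.t1 (C.s2 F) = C.s1 φ), C.c31 (C.c32 F φ) f = C.c32 (C.c31 F f) (C.c21 φ f)
  distrib33_1 : ∀ (F G : C.C3) (f : C.C1) (h : C.t0 (C.s1 (C.s2 F)) = C.s0 f) (h' : C.t2 F = C.s2 G),
    C.c31 (C.c33 F G) f = C.c33 (C.c31 F f) (C.c31 G f)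
  distrib33_2 : ∀ (F G : C.C3) (φ : C.C2) (h : C.t1 (C.s2 F) = C.s1 φ) (h' : C.t2 F = C.s2 G),
    C.c32 (C.c33 F G) φ = C.c33 (C.c32 F φ) (C.c32 G φ)

/-- A 3-precategory.  No interchange law is required. -/
structure Precategory3 extends PrecategoryData3.{u} where
  unit_laws : UnitLaws toPrecategoryData3
  assoc_laws : AssocLaws toPrecategoryData3
  distrib_laws : DistribLaws toPrecategoryData3

/-! ### Lax Gray categories -/

/-- A choice, for every 0-composable pair of 2-cells `φ : f ⇒ f'` and `ψ : g ⇒ g'`, of a 3-cell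
`X φ ψ : (φ ∘₀ g) ∘₁ (f' ∘₀ ψ) ⇛ (f ∘₀ ψ) ∘₁ (φ ∘₀ g')` (compositions in diagrammatic order). -/
structure Interchanger (C : Precategory3.{u}) where
  X : ∀ φ ψ : C.C2, (h : C.t0 (C.s1 φ) = C.s0 (C.s1 ψ) := by first | assumption | (simp [*]; done) | grind) → C.C3
  s2_X : ∀ φ ψ h, C.s2 (X φ ψ h) = C.c22 (C.c21 φ (C.s1 ψ)) (C.c12 (C.t1 φ) ψ)
  t2_X : ∀ φ ψ h, C.t2 (X φ ψ h) = C.c22 (C.c12 (C.s1 φ) ψ) (C.c21 φ (C.t1 ψ))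

attribute [simp, grind =] Interchanger.s2_X Interchanger.t2_X

namespace Interchanger

variable {C : Precategory3.{u}} (I : Interchanger C)

theorem composable_comp_left (φ φ' ψ : C.C2) (h : C.t1 φ = C.s1 φ')
    (h' : C.t0 (C.s1 φ) = C.s0 (C.s1 ψ)) :
    C.t2 (C.c23 (C.c21 φ (C.s1 ψ)) (I.X φ' ψ)) = C.s2 (C.c32 (I.X φ ψ) (C.c21 φ' (C.t1 ψ))) := by
  simp only [C.t2_c23, C.s2_c32, s2_X, t2_X, ← h]
  exact (C.assoc_laws.assoc222 _ _ _ _ _).symm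

theorem composable_comp_right (φ ψ ψ' : C.C2) (h : C.t1 ψ = C.s1 ψ')
    (h' : C.t0 (C.s1 φ) = C.s0 (C.s1 ψ)) :
    C.t2 (C.c32 (I.X φ ψ) (C.c12 (C.t1 φ) ψ')) = C.s2 (C.c23 (C.c12 (C.s1 φ) ψ) (I.X φ ψ')) := by
  simp only [C.t2_c32, C.s2_c23, s2_X, t2_X, ← h]
  exact C.assoc_laws.assoc222 _ _ _ _ _

end Interchanger

/-- The 3-precategory `C` is a lax Gray category with interchangers `I`. -/
structure IsLaxGray (C : Precategory3.{u}) (I : Interchanger C) : Prop where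
  X_id_left : ∀ (f : C.C1) (ψ : C.C2) (h : C.t0 f = C.s0 (C.s1 ψ)),
    I.X (C.id2 f) ψ = C.id3 (C.c12 f ψ)
  X_id_right : ∀ (φ : C.C2) (g : C.C1) (h : C.t0 (C.s1 φ) = C.s0 g),
    I.X φ (C.id2 g) = C.id3 (C.c21 φ g)
  X_comp_left : ∀ (φ φ' ψ : C.C2) (h : C.t1 φ = C.s1 φ') (h' : C.t0 (C.s1 φ) = C.s0 (C.s1 ψ)),
    I.X (C.c22 φ φ') ψ =
      C.c33 (C.c23 (C.c21 φ (C.s1 ψ)) (I.X φ' ψ)) (C.c32 (I.X φ ψ) (C.c21 φ' (C.t1 ψ)))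
        (I.composable_comp_left φ φ' ψ h h')
  X_comp_right : ∀ (φ ψ ψ' : C.C2) (h : C.t1 ψ = C.s1 ψ') (h' : C.t0 (C.s1 φ) = C.s0 (C.s1 ψ)),
    I.X φ (C.c22 ψ ψ') =
      C.c33 (C.c32 (I.X φ ψ) (C.c12 (C.t1 φ) ψ')) (C.c23 (C.c12 (C.s1 φ) ψ) (I.X φ ψ'))
        (I.composable_comp_right φ ψ ψ' h h')
  X_whisker_left : ∀ (e : C.C1) (φ ψ : C.C2) (h : C.t0 e = C.s0 (C.s1 φ))
    (h' : C.t0 (C.s1 φ) = C.s0 (C.s1 ψ)), I.X (C.c12 e φ) ψ = C.c13 e (I.X φ ψ)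
  X_whisker_right : ∀ (φ ψ : C.C2) (k : C.C1) (h : C.t0 (C.s1 φ) = C.s0 (C.s1 ψ))
    (h' : C.t0 (C.s1 ψ) = C.s0 k), I.X φ (C.c21 ψ k) = C.c31 (I.X φ ψ) k
  X_whisker_middle : ∀ (φ : C.C2) (f : C.C1) (ψ : C.C2) (h : C.t0 (C.s1 φ) = C.s0 f)
    (h' : C.t0 f = C.s0 (C.s1 ψ)), I.X (C.c21 φ f) ψ = I.X φ (C.c12 f ψ)
  /-- The exchange law for `A : φ ⇛ φ'` and `B : ψ ⇛ ψ'`. -/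
  exchange : ∀ (A B : C.C3) (h : C.t1 (C.s2 A) = C.s1 (C.s2 B)),
    C.c33 (C.c32 A (C.s2 B)) (C.c23 (C.t2 A) B) = C.c33 (C.c23 (C.s2 A) B) (C.c32 A (C.t2 B))
  /-- Naturality of the interchangers in the first variable. -/
  X_natural_left : ∀ (A : C.C3) (ψ : C.C2) (h : C.t0 (C.s1 (C.s2 A)) = C.s0 (C.s1 ψ)),
    C.c33 (C.c32 (C.c31 A (C.s1 ψ)) (C.c12 (C.t1 (C.s2 A)) ψ)) (I.X (C.t2 A) ψ) =
      C.c33 (I.X (C.s2 A) ψ) (C.c23 (C.c12 (C.s1 (C.s2 A)) ψ) (C.c31 A (C.t1 ψ)))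
  /-- Naturality of the interchangers in the second variable. -/
  X_natural_right : ∀ (φ : C.C2) (B : C.C3) (h : C.t0 (C.s1 φ) = C.s0 (C.s1 (C.s2 B))),
    C.c33 (C.c23 (C.c21 φ (C.s1 (C.s2 B))) (C.c13 (C.t1 φ) B)) (I.X φ (C.t2 B)) =
      C.c33 (I.X φ (C.s2 B)) (C.c32 (C.c13 (C.s1 φ) B) (C.c21 φ (C.t1 (C.s2 B))))

/-! ### Free cells: composable sequences of steps -/

section FreeCell

variable {V E : Type u} {V' E' : Type u}

/-- `Linked s t x l`: the list `l` is a composable sequence of steps starting at `x`. -/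
def Linked (s t : E → V) : V → List E → Prop
  | _, [] => True
  | x, e :: l => s e = x ∧ Linked s t (t e) l

/-- The endpoint of a composable sequence of steps starting at `x`. -/
def endpoint (t : E → V) : V → List E → V
  | x, [] => x
  | _, e :: l => endpoint t (t e) l

/-- A formal composite of composable steps, i.e. a morphism of the free category on the graph
`s, t : E → V`. -/
@[ext]
structure FreeCell (s t : E → V) where
  src : V
  steps : List E
  linked : Linked s t src steps

variable {s t : E → V} {s' t' : E' → V'}

@[simp] theorem endpoint_append (x : V) (l m : List E) :
    endpoint t x (l ++ m) = endpoint t (endpoint t x l) m := by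
  induction l generalizing x with
  | nil => rfl
  | cons e l ih => exact ih _

@[simp] theorem linked_append (x : V) (l m : List E) :
    Linked s t x (l ++ m) ↔ Linked s t x l ∧ Linked s t (endpoint t x l) m := by
  induction l generalizing x with
  | nil => simp [Linked, endpoint]
  | cons e l ih => simp [Linked, endpoint, ih, and_assoc]

namespace FreeCell

/-- The target of a formal composite. -/
def tgt (c : FreeCell s t) : V := endpoint t c.src c.steps

/-- The empty composite. -/
@[simps] def nil (s t : E → V) (x : V) : FreeCell s t := ⟨x, [], trivial⟩

/-- A single step. -/
@[simps] def single (s t : E → V) (e : E) : FreeCell s t := ⟨s e, [e], rfl, trivial⟩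

/-- Concatenation. -/
@[simps] def comp (c d : FreeCell s t) (h : c.tgt = d.src) : FreeCell s t :=
  ⟨c.src, c.steps ++ d.steps, (linked_append _ _ _).2 ⟨c.linked, (congrArg (fun x => Linked s t x d.steps) h).mpr d.linked⟩⟩

@[simp] theorem tgt_nil (x : V) : (nil s t x).tgt = x := of_eq_true (eq_self x)

@[simp] theorem tgt_single (e : E) : (single s t e).tgt = t e := of_eq_true (eq_self _)

@[simp] theorem tgt_comp (c d : FreeCell s t) (h) : (c.comp d h).tgt = d.tgt := by
  simp only [tgt, comp_src, comp_steps, endpoint_append]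
  exact congrArg (fun x => endpoint t x d.steps) h

@[simp] theorem nil_comp (c : FreeCell s t) (x h) : (nil s t x).comp c h = c :=
  FreeCell.ext h rfl

@[simp] theorem comp_nil (c : FreeCell s t) (x h) : c.comp (nil s t x) h = c :=
  FreeCell.ext rfl (List.append_nil _)

@[simp] theorem comp_assoc (c d e : FreeCell s t) (h h') :
    (c.comp d h).comp e h' =
      c.comp (d.comp e ((tgt_comp c d h).symm.trans h')) (by simpa using h) :=
  FreeCell.ext rfl (List.append_assoc _ _ _)

theorem forall_mem {p : V → Prop} (hp : ∀ e, p (s e) → p (t e)) :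
    ∀ (x : V) (l : List E), Linked s t x l → p x → ∀ e ∈ l, p (s e)
  | _, [], _, _, e, he => absurd he List.not_mem_nil
  | x, a :: l, hl, hx, e, he => by
    have ha : p (s a) := hl.1 ▸ hx
    rcases List.mem_cons.1 he with rfl | he
    · exact ha
    · exact forall_mem hp (t a) l hl.2 (hp a ha) e he

theorem linked_pmap {p : V → Prop} (fV : ∀ x, p x → V') (fE : ∀ e, p (s e) → E')
    (hp : ∀ e, p (s e) → p (t e)) (hs : ∀ e h, s' (fE e h) = fV (s e) h)
    (ht : ∀ e h, t' (fE e h) = fV (t e) (hp e h)) :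
    ∀ (x : V) (l : List E) (hx : p x) (hl : Linked s t x l) (hm : ∀ e ∈ l, p (s e)),
      Linked s' t' (fV x hx) (l.pmap fE hm)
  | _, [], _, _, _ => trivial
  | x, a :: l, hx, hl, hm => by
    obtain ⟨rfl, hl⟩ := hl
    refine ⟨hs a hx, ?_⟩
    have := linked_pmap fV fE hp hs ht (t a) l (hp a hx) hl
      (fun e he => hm e (List.mem_cons_of_mem _ he))
    rw [ht a]
    exact this

theorem endpoint_pmap {p : V → Prop} (fV : ∀ x, p x → V') (fE : ∀ e, p (s e) → E')
    (hp : ∀ e, p (s e) → p (t e)) (ht : ∀ e h, t' (fE e h) = fV (t e) (hp e h)) :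
    ∀ (x : V) (l : List E) (hx : p x) (hl : Linked s t x l) (hm : ∀ e ∈ l, p (s e))
      (hy : p (endpoint t x l)),
      endpoint t' (fV x hx) (l.pmap fE hm) = fV (endpoint t x l) hy
  | _, [], _, _, _, _ => rfl
  | x, a :: l, hx, hl, hm, hy => by
    obtain ⟨rfl, hl⟩ := hl
    have := endpoint_pmap fV fE hp ht (t a) l (hp a hx) hl
      (fun e he => hm e (List.mem_cons_of_mem _ he)) hy
    show endpoint t' (t' (fE a _)) _ = _
    rw [ht a]
    exact this

theorem prop_tgt {p : V → Prop} (hp : ∀ e, p (s e) → p (t e)) :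
    ∀ (x : V) (l : List E), Linked s t x l → p x → p (endpoint t x l)
  | _, [], _, hx => hx
  | x, a :: l, hl, hx => prop_tgt hp (t a) l hl.2 (hp a (hl.1 ▸ hx))

/-- The image of a formal composite under a morphism of graphs `(fV, fE)` which is defined on the
vertices satisfying `p` and on the steps whose source satisfies `p`. -/
@[simps] def pmap {p : V → Prop} (fV : ∀ x, p x → V') (fE : ∀ e, p (s e) → E')
    (hp : ∀ e, p (s e) → p (t e)) (hs : ∀ e h, s' (fE e h) = fV (s e) h)
    (ht : ∀ e h, t' (fE e h) = fV (t e) (hp e h)) (c : FreeCell s t) (h : p c.src) :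
    FreeCell s' t' where
  src := fV c.src h
  steps := c.steps.pmap fE (forall_mem hp _ _ c.linked h)
  linked := linked_pmap fV fE hp hs ht _ _ h c.linked _

@[simp] theorem tgt_pmap {p : V → Prop} (fV : ∀ x, p x → V') (fE : ∀ e, p (s e) → E')
    (hp : ∀ e, p (s e) → p (t e)) (hs : ∀ e h, s' (fE e h) = fV (s e) h)
    (ht : ∀ e h, t' (fE e h) = fV (t e) (hp e h)) (c : FreeCell s t) (h : p c.src) :
    (c.pmap fV fE hp hs ht h).tgt = fV c.tgt (prop_tgt hp _ _ c.linked h) :=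
  endpoint_pmap fV fE hp ht _ _ h c.linked _ _

theorem ext_getElem {c d : FreeCell s t} (h : c.src = d.src)
    (hl : c.steps.length = d.steps.length)
    (hs : ∀ i (h : i < c.steps.length) (h' : i < d.steps.length), c.steps[i] = d.steps[i]) :
    c = d :=
  FreeCell.ext h (List.ext_getElem hl hs)

end FreeCell

end FreeCell

/-! ### Prepolygraphs and the 3-precategories they generate -/

/-- A 1-prepolygraph, i.e. a graph. -/
structure Prepolygraph1 where
  P0 : Type u
  P1 : Type u
  s0 : P1 → P0
  t0 : P1 → P0

namespace Prepolygraph1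

/-- The 1-cells generated by a 1-prepolygraph: composites of 1-generators. -/
abbrev Cell1 (P : Prepolygraph1.{u}) : Type u := FreeCell P.s0 P.t0

end Prepolygraph1

/-- A 2-prepolygraph: a 1-prepolygraph with a set of 2-generators between parallel 1-cells. -/
structure Prepolygraph2 extends Prepolygraph1.{u} where
  P2 : Type u
  s1 : P2 → toPrepolygraph1.Cell1
  t1 : P2 → toPrepolygraph1.Cell1
  src_t1 : ∀ α, (t1 α).src = (s1 α).src
  tgt_t1 : ∀ α, (t1 α).tgt = (s1 α).tgt

attribute [simp, grind =] Prepolygraph2.src_t1 Prepolygraph2.tgt_t1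

namespace Prepolygraph2

variable (P : Prepolygraph2.{u})

/-- A 2-dimensional whisker `l ∘₀ α ∘₀ r`. -/
@[ext]
structure Whisker2 where
  l : P.Cell1
  gen : P.P2
  r : P.Cell1
  hl : l.tgt = (P.s1 gen).src
  hr : (P.s1 gen).tgt = r.src

variable {P}

namespace Whisker2

/-- The source of `l ∘₀ α ∘₀ r`. -/
def src (w : P.Whisker2) : P.Cell1 :=
  (w.l.comp (P.s1 w.gen) w.hl).comp w.r (by simp [w.hr])

/-- The target of `l ∘₀ α ∘₀ r`. -/
def tgt (w : P.Whisker2) : P.Cell1 :=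
  (w.l.comp (P.t1 w.gen) (by simp [w.hl])).comp w.r (by simp [w.hr])

@[simp] theorem src_src (w : P.Whisker2) : w.src.src = w.l.src := by simp [src]
@[simp] theorem tgt_src (w : P.Whisker2) : w.tgt.src = w.l.src := by simp [tgt]
@[simp] theorem src_tgt (w : P.Whisker2) : w.src.tgt = w.r.tgt := by simp [src]
@[simp] theorem tgt_tgt (w : P.Whisker2) : w.tgt.tgt = w.r.tgt := by simp [tgt]

/-- `f ∘₀ (l ∘₀ α ∘₀ r)` -/
@[simps] def lw (f : P.Cell1) (w : P.Whisker2) (h : f.tgt = w.src.src) : P.Whisker2 where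
  l := f.comp w.l (h.trans w.src_src)
  gen := w.gen
  r := w.r
  hl := by simp [w.hl]
  hr := w.hr

/-- `(l ∘₀ α ∘₀ r) ∘₀ f` -/
@[simps] def rw (w : P.Whisker2) (f : P.Cell1) (h : w.src.tgt = f.src) : P.Whisker2 where
  l := w.l
  gen := w.gen
  r := w.r.comp f (by simpa using h)
  hl := w.hl
  hr := w.hr

@[simp] theorem src_lw (f : P.Cell1) (w : P.Whisker2) (h) : (w.lw f h).src = f.comp w.src h := by
  simp [src]
@[simp] theorem tgt_lw (f : P.Cell1) (w : P.Whisker2) (h) : (w.lw f h).tgt = f.comp w.tgt h := by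
  simp [tgt]
@[simp] theorem src_rw (w : P.Whisker2) (f : P.Cell1) (h) : (w.rw f h).src = w.src.comp f h := by
  simp [src]
@[simp] theorem tgt_rw (w : P.Whisker2) (f : P.Cell1) (h) :
    (w.rw f h).tgt = w.tgt.comp f (by simpa using h) := by
  simp [tgt]

end Whisker2

variable (P) in
/-- The 2-cells generated by a 2-prepolygraph: 1-composites of whiskers. -/
abbrev Cell2 : Type u := FreeCell (Whisker2.src (P := P)) Whisker2.tgt

namespace Cell2

theorem src_tgt_eq (φ : P.Cell2) : φ.tgt.src = φ.src.src :=
  FreeCell.prop_tgt (p := fun x => x.src = φ.src.src) (fun w h => by simpa using h) _ _ φ.linked rfl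

theorem tgt_tgt_eq (φ : P.Cell2) : φ.tgt.tgt = φ.src.tgt :=
  FreeCell.prop_tgt (p := fun x => x.tgt = φ.src.tgt) (fun w h => by simpa using h) _ _ φ.linked rfl

attribute [simp] src_tgt_eq tgt_tgt_eq

/-- `f ∘₀ φ`, computed whisker by whisker. -/
def lw (f : P.Cell1) (φ : P.Cell2) (h : f.tgt = φ.src.src) : P.Cell2 :=
  φ.pmap (p := fun x => f.tgt = x.src) (fun x hx => f.comp x hx) (fun w hw => w.lw f hw)
    (fun w hw => by simpa using hw) (by simp) (by simp) h

/-- `φ ∘₀ f`, computed whisker by whisker. -/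
def rw (φ : P.Cell2) (f : P.Cell1) (h : φ.src.tgt = f.src) : P.Cell2 :=
  φ.pmap (p := fun x => x.tgt = f.src) (fun x hx => x.comp f hx) (fun w hw => w.rw f hw)
    (fun w hw => by simpa using hw) (by simp) (by simp) h


@[simp] theorem src_lw (f : P.Cell1) (φ : P.Cell2) (h) : (φ.lw f h).src = f.comp φ.src h := by
  simp [lw]
@[simp] theorem tgt_lw (f : P.Cell1) (φ : P.Cell2) (h) :
    (φ.lw f h).tgt = f.comp φ.tgt (h.trans φ.src_tgt_eq.symm) := by
  simp [lw]
@[simp] theorem src_rw (φ : P.Cell2) (f : P.Cell1) (h) : (φ.rw f h).src = φ.src.comp f h := by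
  simp [rw]
@[simp] theorem tgt_rw (φ : P.Cell2) (f : P.Cell1) (h) :
    (φ.rw f h).tgt = φ.tgt.comp f (φ.tgt_tgt_eq.trans h) := by
  simp [rw]

@[simp] theorem lw_nil (f g : P.Cell1) (h) :
    lw f (FreeCell.nil _ _ g : P.Cell2) h = FreeCell.nil _ _ (f.comp g h) :=
  FreeCell.ext (by simp) (by simp [lw])
@[simp] theorem rw_nil (f g : P.Cell1) (h) :
    rw (FreeCell.nil _ _ g : P.Cell2) f h = FreeCell.nil _ _ (g.comp f h) :=
  FreeCell.ext (by simp) (by simp [rw])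

@[simp] theorem lw_comp (f : P.Cell1) (φ ψ : P.Cell2) (h h') :
    lw f (φ.comp ψ h) h' = (φ.lw f (by simpa using h')).comp
      (ψ.lw f (h'.trans (by simpa using congrArg FreeCell.src h))) (by simp [h]) :=
  FreeCell.ext (by simp) (by simp [lw])
@[simp] theorem rw_comp (φ ψ : P.Cell2) (f : P.Cell1) (h h') :
    rw (φ.comp ψ h) f h' = (φ.rw f (by simpa using h')).comp
      (ψ.rw f ((by simpa using (congrArg FreeCell.tgt h).symm : _ = φ.src.tgt).trans h')) (by simp [h]) :=
  FreeCell.ext (by simp) (by simp [rw])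

@[simp] theorem nil_lw (x : P.P0) (φ : P.Cell2) (h) : lw (FreeCell.nil _ _ x) φ h = φ :=
  FreeCell.ext_getElem (by simp) (by simp [lw]) fun i _ _ =>
    Whisker2.ext (by simp [lw]) (by simp [lw]) (by simp [lw])
@[simp] theorem rw_nil_right (x : P.P0) (φ : P.Cell2) (h) : rw φ (FreeCell.nil _ _ x) h = φ :=
  FreeCell.ext_getElem (by simp) (by simp [rw]) fun i _ _ =>
    Whisker2.ext (by simp [rw]) (by simp [rw]) (by simp [rw])

@[simp] theorem lw_lw (f g : P.Cell1) (φ : P.Cell2) (h h') :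
    lw f (lw g φ h) h' = lw (f.comp g (by simpa using h')) φ (by simpa using h) :=
  FreeCell.ext_getElem (by simp) (by simp [lw]) fun i _ _ =>
    Whisker2.ext (by simp [lw]) (by simp [lw]) (by simp [lw])
@[simp] theorem rw_rw (φ : P.Cell2) (f g : P.Cell1) (h h') :
    rw (rw φ f h) g h' = rw φ (f.comp g (by simpa using h')) (by simpa using h) :=
  FreeCell.ext_getElem (by simp) (by simp [rw]) fun i _ _ =>
    Whisker2.ext (by simp [rw]) (by simp [rw]) (by simp [rw])
@[simp] theorem rw_lw (f : P.Cell1) (φ : P.Cell2) (g : P.Cell1) (h h') :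
    rw (lw f φ h) g h' = lw f (rw φ g (by simpa using h')) (by simpa using h) :=
  FreeCell.ext_getElem (by simp) (by simp [lw, rw]) fun i _ _ =>
    Whisker2.ext (by simp [lw, rw]) (by simp [lw, rw]) (by simp [lw, rw])

end Cell2

/-- The 2-cell given by a 2-generator. -/
def genCell2 (α : P.P2) : P.Cell2 :=
  FreeCell.single _ _ ⟨FreeCell.nil _ _ (P.s1 α).src, α, FreeCell.nil _ _ (P.s1 α).tgt, by simp, by simp⟩

@[simp] theorem src_genCell2 (α : P.P2) : (genCell2 α).src = P.s1 α := by
  simp [genCell2, Whisker2.src]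
@[simp] theorem tgt_genCell2 (α : P.P2) : (genCell2 α).tgt = P.t1 α := by
  simp [genCell2, Whisker2.tgt]

end Prepolygraph2

/-- A 3-prepolygraph: a 2-prepolygraph with a set of 3-generators between parallel 2-cells. -/
structure Prepolygraph3 extends Prepolygraph2.{u} where
  P3 : Type u
  s2 : P3 → toPrepolygraph2.Cell2
  t2 : P3 → toPrepolygraph2.Cell2
  src_t2 : ∀ A, (t2 A).src = (s2 A).src
  tgt_t2 : ∀ A, (t2 A).tgt = (s2 A).tgt

attribute [simp, grind =] Prepolygraph3.src_t2 Prepolygraph3.tgt_t2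

namespace Prepolygraph3

variable (P : Prepolygraph3.{u})

/-- A 3-dimensional whisker `lam ∘₁ (l ∘₀ A ∘₀ r) ∘₁ rho`. -/
@[ext]
structure Whisker3 where
  lam : P.Cell2
  l : P.Cell1
  gen : P.P3
  r : P.Cell1
  rho : P.Cell2
  hl : l.tgt = (P.s2 gen).src.src
  hr : (P.s2 gen).src.tgt = r.src
  hlam : lam.tgt = (l.comp (P.s2 gen).src hl).comp r (by simp [hr])
  hrho : (l.comp (P.s2 gen).tgt (by simp [hl])).comp r (by simp [hr]) = rho.src

variable {P}

namespace Whisker3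

/-- The source of `lam ∘₁ (l ∘₀ A ∘₀ r) ∘₁ rho`. -/
def src (w : P.Whisker3) : P.Cell2 :=
  (w.lam.comp (((P.s2 w.gen).lw w.l w.hl).rw w.r (by simp [w.hr])) (by simp [w.hlam])).comp w.rho
    (by simp [← w.hrho])

/-- The target of `lam ∘₁ (l ∘₀ A ∘₀ r) ∘₁ rho`. -/
def tgt (w : P.Whisker3) : P.Cell2 :=
  (w.lam.comp (((P.t2 w.gen).lw w.l (by simp [w.hl])).rw w.r (by simp [w.hr]))
    (by simp [w.hlam])).comp w.rho (by simp [← w.hrho])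

@[simp] theorem src_src (w : P.Whisker3) : w.src.src = w.lam.src := by simp [src]
@[simp] theorem tgt_src (w : P.Whisker3) : w.tgt.src = w.lam.src := by simp [tgt]
@[simp] theorem src_tgt (w : P.Whisker3) : w.src.tgt = w.rho.tgt := by simp [src]
@[simp] theorem tgt_tgt (w : P.Whisker3) : w.tgt.tgt = w.rho.tgt := by simp [tgt]

theorem lam_src_src (w : P.Whisker3) : w.lam.src.src = w.l.src := by
  have := congrArg FreeCell.src w.hlam; simpa using this
theorem lam_src_tgt (w : P.Whisker3) : w.lam.src.tgt = w.r.tgt := by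
  have := congrArg FreeCell.tgt w.hlam; simpa using this
theorem rho_src_src (w : P.Whisker3) : w.rho.src.src = w.l.src := by
  have := congrArg FreeCell.src w.hrho; simpa using this.symm
theorem rho_src_tgt (w : P.Whisker3) : w.rho.src.tgt = w.r.tgt := by
  have := congrArg FreeCell.tgt w.hrho; simpa using this.symm

/-- `f ∘₀ w` -/
@[simps] def lw0 (f : P.Cell1) (w : P.Whisker3) (h : f.tgt = w.src.src.src) : P.Whisker3 where
  lam := w.lam.lw f (by simpa using h)
  l := f.comp w.l (by rw [h]; simp [w.lam_src_src])
  gen := w.gen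
  r := w.r
  rho := w.rho.lw f (by rw [h]; simp [w.lam_src_src, w.rho_src_src])
  hl := by simp [w.hl]
  hr := w.hr
  hlam := by simp [w.hlam]
  hrho := by simp [← w.hrho]

/-- `w ∘₀ f` -/
@[simps] def rw0 (w : P.Whisker3) (f : P.Cell1) (h : w.src.src.tgt = f.src) : P.Whisker3 where
  lam := w.lam.rw f (by simpa using h)
  l := w.l
  gen := w.gen
  r := w.r.comp f (by rw [← h]; simp [w.lam_src_tgt])
  rho := w.rho.rw f (by rw [← h]; simp [w.lam_src_tgt, w.rho_src_tgt])
  hl := w.hl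
  hr := by simp [w.hr]
  hlam := by simp [w.hlam]
  hrho := by simp [← w.hrho]

/-- `φ ∘₁ w` -/
@[simps] def lw1 (φ : P.Cell2) (w : P.Whisker3) (h : φ.tgt = w.src.src) : P.Whisker3 where
  lam := φ.comp w.lam (by simpa using h)
  l := w.l
  gen := w.gen
  r := w.r
  rho := w.rho
  hl := w.hl
  hr := w.hr
  hlam := by simp [w.hlam]
  hrho := w.hrho

/-- `w ∘₁ φ` -/
@[simps] def rw1 (w : P.Whisker3) (φ : P.Cell2) (h : w.src.tgt = φ.src) : P.Whisker3 where
  lam := w.lam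
  l := w.l
  gen := w.gen
  r := w.r
  rho := w.rho.comp φ (by simpa using h)
  hl := w.hl
  hr := w.hr
  hlam := w.hlam
  hrho := by simp [← w.hrho]

@[simp] theorem src_lw0 (f : P.Cell1) (w : P.Whisker3) (h) :
    (w.lw0 f h).src = w.src.lw f h := by simp [src]
@[simp] theorem tgt_lw0 (f : P.Cell1) (w : P.Whisker3) (h) :
    (w.lw0 f h).tgt = w.tgt.lw f (by simpa using h) := by simp [tgt]
@[simp] theorem src_rw0 (w : P.Whisker3) (f : P.Cell1) (h) :
    (w.rw0 f h).src = w.src.rw f h := by simp [src]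
@[simp] theorem tgt_rw0 (w : P.Whisker3) (f : P.Cell1) (h) :
    (w.rw0 f h).tgt = w.tgt.rw f (by simpa using h) := by simp [tgt]
@[simp] theorem src_lw1 (φ : P.Cell2) (w : P.Whisker3) (h) :
    (w.lw1 φ h).src = φ.comp w.src h := by simp [src]
@[simp] theorem tgt_lw1 (φ : P.Cell2) (w : P.Whisker3) (h) :
    (w.lw1 φ h).tgt = φ.comp w.tgt (by simpa using h) := by simp [tgt]
@[simp] theorem src_rw1 (w : P.Whisker3) (φ : P.Cell2) (h) :
    (w.rw1 φ h).src = w.src.comp φ h := by simp [src]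
@[simp] theorem tgt_rw1 (w : P.Whisker3) (φ : P.Cell2) (h) :
    (w.rw1 φ h).tgt = w.tgt.comp φ (by simpa using h) := by simp [tgt]

end Whisker3

variable (P) in
/-- The 3-cells generated by a 3-prepolygraph: 2-composites of whiskers. -/
abbrev Cell3 : Type u := FreeCell (Whisker3.src (P := P)) Whisker3.tgt

namespace Cell3

@[simp] theorem src_tgt_eq (F : P.Cell3) : F.tgt.src = F.src.src :=
  FreeCell.prop_tgt (p := fun x => x.src = F.src.src) (fun w h => by simpa using h) _ _ F.linked rfl

@[simp] theorem tgt_tgt_eq (F : P.Cell3) : F.tgt.tgt = F.src.tgt :=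
  FreeCell.prop_tgt (p := fun x => x.tgt = F.src.tgt) (fun w h => by simpa using h) _ _ F.linked rfl

/-- `f ∘₀ F`, computed whisker by whisker. -/
def lw0 (f : P.Cell1) (F : P.Cell3) (h : f.tgt = F.src.src.src) : P.Cell3 :=
  F.pmap (p := fun x => f.tgt = x.src.src) (fun x hx => x.lw f hx) (fun w hw => w.lw0 f hw)
    (fun w hw => by simpa using hw) (by simp) (by simp) h

/-- `F ∘₀ f`, computed whisker by whisker. -/
def rw0 (F : P.Cell3) (f : P.Cell1) (h : F.src.src.tgt = f.src) : P.Cell3 :=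
  F.pmap (p := fun x => x.src.tgt = f.src) (fun x hx => x.rw f hx) (fun w hw => w.rw0 f hw)
    (fun w hw => by simpa using hw) (by simp) (by simp) h

/-- `φ ∘₁ F`, computed whisker by whisker. -/
def lw1 (φ : P.Cell2) (F : P.Cell3) (h : φ.tgt = F.src.src) : P.Cell3 :=
  F.pmap (p := fun x => φ.tgt = x.src) (fun x hx => φ.comp x hx) (fun w hw => w.lw1 φ hw)
    (fun w hw => by simpa using hw) (by simp) (by simp) h

/-- `F ∘₁ φ`, computed whisker by whisker. -/
def rw1 (F : P.Cell3) (φ : P.Cell2) (h : F.src.tgt = φ.src) : P.Cell3 :=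
  F.pmap (p := fun x => x.tgt = φ.src) (fun x hx => x.comp φ hx) (fun w hw => w.rw1 φ hw)
    (fun w hw => by simpa using hw) (by simp) (by simp) h


@[simp] theorem src_lw0 (f : P.Cell1) (F : P.Cell3) (h) : (F.lw0 f h).src = F.src.lw f h := by
  simp [lw0]
@[simp] theorem tgt_lw0 (f : P.Cell1) (F : P.Cell3) (h) :
    (F.lw0 f h).tgt = F.tgt.lw f (by simpa using h) := by
  simp [lw0]
@[simp] theorem src_rw0 (F : P.Cell3) (f : P.Cell1) (h) : (F.rw0 f h).src = F.src.rw f h := by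
  simp [rw0]
@[simp] theorem tgt_rw0 (F : P.Cell3) (f : P.Cell1) (h) :
    (F.rw0 f h).tgt = F.tgt.rw f (by simpa using h) := by
  simp [rw0]
@[simp] theorem src_lw1 (φ : P.Cell2) (F : P.Cell3) (h) : (F.lw1 φ h).src = φ.comp F.src h := by
  simp [lw1]
@[simp] theorem tgt_lw1 (φ : P.Cell2) (F : P.Cell3) (h) :
    (F.lw1 φ h).tgt = φ.comp F.tgt (by simpa using h) := by
  simp [lw1]
@[simp] theorem src_rw1 (F : P.Cell3) (φ : P.Cell2) (h) : (F.rw1 φ h).src = F.src.comp φ h := by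
  simp [rw1]
@[simp] theorem tgt_rw1 (F : P.Cell3) (φ : P.Cell2) (h) :
    (F.rw1 φ h).tgt = F.tgt.comp φ (by simpa using h) := by
  simp [rw1]

@[simp] theorem lw0_id (x : P.P0) (F : P.Cell3) (h) : lw0 (FreeCell.nil _ _ x) F h = F :=
  FreeCell.ext_getElem (by simp) (by simp [lw0]) fun _ _ _ => by
    apply Whisker3.ext <;> simp [lw0]

@[simp] theorem rw0_id (x : P.P0) (F : P.Cell3) (h) : rw0 F (FreeCell.nil _ _ x) h = F :=
  FreeCell.ext_getElem (by simp) (by simp [rw0]) fun _ _ _ => by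
    apply Whisker3.ext <;> simp [rw0]

@[simp] theorem lw1_id (f : P.Cell1) (F : P.Cell3) (h) : lw1 (FreeCell.nil _ _ f) F h = F :=
  FreeCell.ext_getElem (by simp) (by simp [lw1]) fun _ _ _ => by
    apply Whisker3.ext <;> simp [lw1]

@[simp] theorem rw1_id (f : P.Cell1) (F : P.Cell3) (h) : rw1 F (FreeCell.nil _ _ f) h = F :=
  FreeCell.ext_getElem (by simp) (by simp [rw1]) fun _ _ _ => by
    apply Whisker3.ext <;> simp [rw1]

@[simp] theorem lw0_nil (f : P.Cell1) (φ : P.Cell2) (h) :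
    lw0 f (FreeCell.nil _ _ φ : P.Cell3) h = FreeCell.nil _ _ (φ.lw f (by simpa using h)) :=
  FreeCell.ext (by simp) (by simp [lw0])

@[simp] theorem rw0_nil (f : P.Cell1) (φ : P.Cell2) (h) :
    rw0 (FreeCell.nil _ _ φ : P.Cell3) f h = FreeCell.nil _ _ (φ.rw f (by simpa using h)) :=
  FreeCell.ext (by simp) (by simp [rw0])

@[simp] theorem lw1_nil (φ ψ : P.Cell2) (h) :
    lw1 φ (FreeCell.nil _ _ ψ : P.Cell3) h = FreeCell.nil _ _ (φ.comp ψ (by simpa using h)) :=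
  FreeCell.ext (by simp) (by simp [lw1])

@[simp] theorem rw1_nil (φ ψ : P.Cell2) (h) :
    rw1 (FreeCell.nil _ _ φ : P.Cell3) ψ h = FreeCell.nil _ _ (φ.comp ψ (by simpa using h)) :=
  FreeCell.ext (by simp) (by simp [rw1])

@[simp] theorem lw0_lw0 (f g : P.Cell1) (F : P.Cell3) (h h') :
    lw0 f (lw0 g F h) h' = lw0 (f.comp g (by simpa using h')) F (by simpa using h) :=
  FreeCell.ext_getElem (by simp) (by simp [lw0]) fun _ _ _ => by
    apply Whisker3.ext <;> simp [lw0]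

@[simp] theorem rw0_rw0 (f g : P.Cell1) (F : P.Cell3) (h h') :
    rw0 (rw0 F f h) g h' = rw0 F (f.comp g (by simpa using h')) (by simpa using h) :=
  FreeCell.ext_getElem (by simp) (by simp [rw0]) fun _ _ _ => by
    apply Whisker3.ext <;> simp [rw0]

@[simp] theorem rw0_lw0 (f g : P.Cell1) (F : P.Cell3) (h h') :
    rw0 (lw0 f F h) g h' = lw0 f (rw0 F g (by simpa using h')) (by simpa using h) :=
  FreeCell.ext_getElem (by simp) (by simp [lw0, rw0]) fun _ _ _ => by
    apply Whisker3.ext <;> simp [lw0, rw0]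

@[simp] theorem lw1_lw1 (φ ψ : P.Cell2) (F : P.Cell3) (h h') :
    lw1 φ (lw1 ψ F h) h' = lw1 (φ.comp ψ (by simpa using h')) F (by simpa using h) :=
  FreeCell.ext_getElem (by simp) (by simp [lw1]) fun _ _ _ => by
    apply Whisker3.ext <;> simp [lw1]

@[simp] theorem rw1_rw1 (φ ψ : P.Cell2) (F : P.Cell3) (h h') :
    rw1 (rw1 F φ h) ψ h' = rw1 F (φ.comp ψ (by simpa using h')) (by simpa using h) :=
  FreeCell.ext_getElem (by simp) (by simp [rw1]) fun _ _ _ => by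
    apply Whisker3.ext <;> simp [rw1]

@[simp] theorem rw1_lw1 (φ ψ : P.Cell2) (F : P.Cell3) (h h') :
    rw1 (lw1 φ F h) ψ h' = lw1 φ (rw1 F ψ (by simpa using h')) (by simpa using h) :=
  FreeCell.ext_getElem (by simp) (by simp [lw1, rw1]) fun _ _ _ => by
    apply Whisker3.ext <;> simp [lw1, rw1]

@[simp] theorem lw0_lw1 (f : P.Cell1) (φ : P.Cell2) (F : P.Cell3) (h h') :
    lw0 f (lw1 φ F h) h' = lw1 (φ.lw f (by simpa using h'))
      (lw0 f F (by rw [← h]; simpa using h')) (by simp [h]) :=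
  FreeCell.ext_getElem (by simp) (by simp [lw0, lw1]) fun _ _ _ => by
    apply Whisker3.ext <;> simp [lw0, lw1]

@[simp] theorem lw0_rw1 (f : P.Cell1) (F : P.Cell3) (φ : P.Cell2) (h h') :
    lw0 f (rw1 F φ h) h' = rw1 (lw0 f F (by simpa using h'))
      (φ.lw f (by rw [← h]; simpa using h')) (by simp [h]) :=
  FreeCell.ext_getElem (by simp) (by simp [lw0, rw1]) fun _ _ _ => by
    apply Whisker3.ext <;> simp [lw0, rw1]

@[simp] theorem rw0_lw1 (φ : P.Cell2) (F : P.Cell3) (f : P.Cell1) (h h') :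
    rw0 (lw1 φ F h) f h' = lw1 (φ.rw f (by simpa using h'))
      (rw0 F f (by rw [← h]; simpa using h')) (by simp [h]) :=
  FreeCell.ext_getElem (by simp) (by simp [rw0, lw1]) fun _ _ _ => by
    apply Whisker3.ext <;> simp [rw0, lw1]

@[simp] theorem rw0_rw1 (F : P.Cell3) (φ : P.Cell2) (f : P.Cell1) (h h') :
    rw0 (rw1 F φ h) f h' = rw1 (rw0 F f (by simpa using h'))
      (φ.rw f (by rw [← h]; simpa using h')) (by simp [h]) :=
  FreeCell.ext_getElem (by simp) (by simp [rw0, rw1]) fun _ _ _ => by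
    apply Whisker3.ext <;> simp [rw0, rw1]

@[simp] theorem lw0_comp (f : P.Cell1) (F G : P.Cell3) (h h') :
    lw0 f (F.comp G h) h' = (lw0 f F (by simpa using h')).comp
      (lw0 f G (by rw [← h]; simpa using h')) (by simp [h]) :=
  FreeCell.ext (by simp) (by simp [lw0])

@[simp] theorem rw0_comp (f : P.Cell1) (F G : P.Cell3) (h h') :
    rw0 (F.comp G h) f h' = (rw0 F f (by simpa using h')).comp
      (rw0 G f (by rw [← h]; simpa using h')) (by simp [h]) :=
  FreeCell.ext (by simp) (by simp [rw0])

@[simp] theorem lw1_comp (φ : P.Cell2) (F G : P.Cell3) (h h') :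
    lw1 φ (F.comp G h) h' = (lw1 φ F (by simpa using h')).comp
      (lw1 φ G (by rw [← h]; simpa using h')) (by simp [h]) :=
  FreeCell.ext (by simp) (by simp [lw1])

@[simp] theorem rw1_comp (φ : P.Cell2) (F G : P.Cell3) (h h') :
    rw1 (F.comp G h) φ h' = (rw1 F φ (by simpa using h')).comp
      (rw1 G φ (by rw [← h]; simpa using h')) (by simp [h]) :=
  FreeCell.ext (by simp) (by simp [rw1])

end Cell3

/-- The 3-cell given by a 3-generator. -/
def genCell3 (A : P.P3) : P.Cell3 :=
  FreeCell.single _ _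
    { lam := FreeCell.nil _ _ (P.s2 A).src
      l := FreeCell.nil _ _ (P.s2 A).src.src
      gen := A
      r := FreeCell.nil _ _ (P.s2 A).src.tgt
      rho := FreeCell.nil _ _ (P.s2 A).tgt
      hl := by simp
      hr := by simp
      hlam := by simp
      hrho := by simp }

@[simp] theorem src_genCell3 (A : P.P3) : (genCell3 A).src = P.s2 A := by
  simp [genCell3, Whisker3.src]
@[simp] theorem tgt_genCell3 (A : P.P3) : (genCell3 A).tgt = P.t2 A := by
  simp [genCell3, Whisker3.tgt]

end Prepolygraph3

namespace Prepolygraph3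

variable (P : Prepolygraph3.{u})

/-- The globular set of cells generated by a 3-prepolygraph, with its compositions. -/
def freeData : PrecategoryData3.{u} where
  C0 := P.P0
  C1 := P.Cell1
  C2 := P.Cell2
  C3 := P.Cell3
  s0 := FreeCell.src
  t0 := FreeCell.tgt
  s1 := FreeCell.src
  t1 := FreeCell.tgt
  s2 := FreeCell.src
  t2 := FreeCell.tgt
  s0_t1 := by simp
  t0_t1 := by simp
  s1_t2 := by simp
  t1_t2 := by simp
  id1 := FreeCell.nil _ _
  id2 := FreeCell.nil _ _
  id3 := FreeCell.nil _ _
  c11 := FreeCell.comp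
  c12 := Prepolygraph2.Cell2.lw
  c21 := Prepolygraph2.Cell2.rw
  c13 := Cell3.lw0
  c31 := Cell3.rw0
  c22 := FreeCell.comp
  c23 := Cell3.lw1
  c32 := Cell3.rw1
  c33 := FreeCell.comp
  s0_id1 := by simp
  t0_id1 := by simp
  s1_id2 := by simp
  t1_id2 := by simp
  s2_id3 := by simp
  t2_id3 := by simp
  s0_c11 := by simp
  t0_c11 := by simp
  s1_c12 := by simp
  t1_c12 := by simp
  s1_c21 := by simp
  t1_c21 := by simp
  s2_c13 := by simp
  t2_c13 := by simp
  s2_c31 := by simp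
  t2_c31 := by simp
  s1_c22 := by simp
  t1_c22 := by simp
  s2_c23 := by simp
  t2_c23 := by simp
  s2_c32 := by simp
  t2_c32 := by simp
  s2_c33 := by simp
  t2_c33 := by simp

theorem freeData_unitLaws : UnitLaws P.freeData where
  id_c11 := by intros; exact FreeCell.nil_comp _ _ (FreeCell.tgt_nil _)
  id_c12 := by intros; exact Prepolygraph2.Cell2.nil_lw _ _ _
  id_c13 := by intros; exact Cell3.lw0_id _ _ _
  id_c22 := by intros; exact FreeCell.nil_comp _ _ (FreeCell.tgt_nil _)
  id_c23 := by intros; exact Cell3.lw1_id _ _ _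
  id_c33 := by intros; exact FreeCell.nil_comp _ _ (FreeCell.tgt_nil _)
  id_c21 := by intros; exact Prepolygraph2.Cell2.rw_nil _ _ _
  id_c31 := by intros; exact Cell3.rw0_nil _ _ _
  id_c32 := by intros; exact Cell3.rw1_nil _ _ _
  c11_id := by intros; exact FreeCell.comp_nil _ _ rfl
  c21_id := by intros; exact Prepolygraph2.Cell2.rw_nil_right _ _ _
  c31_id := by intros; exact Cell3.rw0_id _ _ _
  c22_id := by intros; exact FreeCell.comp_nil _ _ rfl
  c32_id := by intros; exact Cell3.rw1_id _ _ _
  c33_id := by intros; exact FreeCell.comp_nil _ _ rfl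
  c12_id := by intros; exact Prepolygraph2.Cell2.lw_nil _ _ _
  c13_id := by intros; exact Cell3.lw0_nil _ _ _
  c23_id := by intros; exact Cell3.lw1_nil _ _ _

theorem freeData_assocLaws : AssocLaws P.freeData where
  assoc111 := fun c d e h h' => FreeCell.comp_assoc c d e h ((FreeCell.tgt_comp c d h).trans h')
  assoc112 := by intros; exact (Prepolygraph2.Cell2.lw_lw _ _ _ _ _).symm
  assoc121 := by intros; exact Prepolygraph2.Cell2.rw_lw _ _ _ _ _
  assoc211 := by intros; exact Prepolygraph2.Cell2.rw_rw _ _ _ _ _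
  assoc113 := by intros; exact (Cell3.lw0_lw0 _ _ _ _ _).symm
  assoc131 := by intros; exact Cell3.rw0_lw0 _ _ _ _ _
  assoc311 := by intros; exact Cell3.rw0_rw0 _ _ _ _ _
  assoc222 := fun c d e h h' => FreeCell.comp_assoc c d e h ((FreeCell.tgt_comp c d h).trans h')
  assoc223 := by intros; exact (Cell3.lw1_lw1 _ _ _ _ _).symm
  assoc232 := by intros; exact Cell3.rw1_lw1 _ _ _ _ _
  assoc322 := by intros; exact Cell3.rw1_rw1 _ _ _ _ _
  assoc333 := fun c d e h h' => FreeCell.comp_assoc c d e h ((FreeCell.tgt_comp c d h).trans h')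

theorem freeData_distribLaws : DistribLaws P.freeData where
  distrib1_22 := by intros; apply Prepolygraph2.Cell2.lw_comp <;> assumption
  distrib1_23 := by intros; apply Cell3.lw0_lw1
  distrib1_32 := by intros; apply Cell3.lw0_rw1
  distrib1_33 := by intros; apply Cell3.lw0_comp <;> assumption
  distrib2_33 := by intros; apply Cell3.lw1_comp <;> assumption
  distrib22_1 := by intros; apply Prepolygraph2.Cell2.rw_comp <;> assumption
  distrib23_1 := by intros; apply Cell3.rw0_lw1
  distrib32_1 := by intros; apply Cell3.rw0_rw1
  distrib33_1 := by intros; apply Cell3.rw0_comp <;> assumption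
  distrib33_2 := by intros; apply Cell3.rw1_comp <;> assumption

/-- The free 3-precategory on a 3-prepolygraph, built explicitly: a `(k+1)`-cell is a composable
sequence of whiskers of `(k+1)`-generators, the top composition is concatenation, and the other
compositions act on each whisker. -/
def free : Precategory3.{u} where
  toPrecategoryData3 := P.freeData
  unit_laws := P.freeData_unitLaws
  assoc_laws := P.freeData_assocLaws
  distrib_laws := P.freeData_distribLaws

end Prepolygraph3

/-! ### Quotients of 3-precategories on 3-cells -/

namespace Precategory3

variable (C : Precategory3.{u})

/-- The smallest congruence on the 3-cells of `C` containing `R`: the smallest equivalence relation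
containing `R` and stable under all compositions. -/
inductive Cong (R : C.C3 → C.C3 → Prop) : C.C3 → C.C3 → Prop
  | of {F G : C.C3} : R F G → Cong R F G
  | refl (F : C.C3) : Cong R F F
  | symm {F G : C.C3} : Cong R F G → Cong R G F
  | trans {F G H : C.C3} : Cong R F G → Cong R G H → Cong R F H
  | c13 (f : C.C1) {F G : C.C3} (h h') : Cong R F G → Cong R (C.c13 f F h) (C.c13 f G h')
  | c31 (f : C.C1) {F G : C.C3} (h h') : Cong R F G → Cong R (C.c31 F f h) (C.c31 G f h')
  | c23 (φ : C.C2) {F G : C.C3} (h h') : Cong R F G → Cong R (C.c23 φ F h) (C.c23 φ G h')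
  | c32 (φ : C.C2) {F G : C.C3} (h h') : Cong R F G → Cong R (C.c32 F φ h) (C.c32 G φ h')
  | c33 {F F' G G' : C.C3} (h h') : Cong R F F' → Cong R G G' →
      Cong R (C.c33 F G h) (C.c33 F' G' h')

/-- `R` only relates parallel 3-cells. -/
def IsParallel (R : C.C3 → C.C3 → Prop) : Prop :=
  ∀ F G, R F G → C.s2 F = C.s2 G ∧ C.t2 F = C.t2 G

variable {C} {R : C.C3 → C.C3 → Prop}

theorem Cong.parallel (hR : C.IsParallel R) {F G : C.C3} (h : Cong C R F G) :
    C.s2 F = C.s2 G ∧ C.t2 F = C.t2 G := by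
  induction h with
  | of h => exact hR _ _ h
  | refl => exact ⟨rfl, rfl⟩
  | symm _ ih => exact ⟨ih.1.symm, ih.2.symm⟩
  | trans _ _ ih ih' => exact ⟨ih.1.trans ih'.1, ih.2.trans ih'.2⟩
  | c13 f h h' _ ih => simp [ih.1, ih.2]
  | c31 f h h' _ ih => simp [ih.1, ih.2]
  | c23 f h h' _ ih => simp [ih.1, ih.2]
  | c32 f h h' _ ih => simp [ih.1, ih.2]
  | c33 h h' _ _ ih ih' => simp [ih.1, ih'.2]

variable (C R) in
/-- The congruence generated by `R`, as a setoid. -/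
def congSetoid : Setoid C.C3 := ⟨Cong C R, Cong.refl, Cong.symm, Cong.trans⟩

variable (C R) in
/-- The 3-cells of the quotient. -/
abbrev QCell3 : Type u := Quotient (congSetoid C R)

section

variable (hR : C.IsParallel R)

/-- The source of a class of 3-cells. -/
def qs2 : QCell3 C R → C.C2 := Quotient.lift C.s2 fun _ _ h => (Cong.parallel hR h).1

/-- The target of a class of 3-cells. -/
def qt2 : QCell3 C R → C.C2 := Quotient.lift C.t2 fun _ _ h => (Cong.parallel hR h).2

variable {hR}

@[simp] theorem qs2_mk (F : C.C3) : qs2 hR (Quotient.mk _ F) = C.s2 F := rfl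
@[simp] theorem qt2_mk (F : C.C3) : qt2 hR (Quotient.mk _ F) = C.t2 F := rfl

/-- Functions on classes of 3-cells satisfying `p`, defined on representatives. -/
def qlift {β : Type u} {p : QCell3 C R → Prop} (f : ∀ F : C.C3, p (Quotient.mk _ F) → β)
    (hf : ∀ F G, Cong C R F G → ∀ h h', f F h = f G h') (F : QCell3 C R) (h : p F) : β :=
  Quotient.hrecOn (motive := fun F => p F → β) F f
    (fun F G hFG => Function.hfunext (congrArg p (Quotient.sound hFG))
      fun h h' _ => heq_of_eq (hf F G hFG h h')) h

variable (hR)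

/-- The globular set and the operations of the quotient of `C` by the congruence generated by `R`.
The compositions are computed on representatives. -/
def quotientData : PrecategoryData3.{u} where
  C0 := C.C0
  C1 := C.C1
  C2 := C.C2
  C3 := QCell3 C R
  s0 := C.s0
  t0 := C.t0
  s1 := C.s1
  t1 := C.t1
  s2 := qs2 hR
  t2 := qt2 hR
  s0_t1 := C.s0_t1
  t0_t1 := C.t0_t1
  s1_t2 := by rintro ⟨F⟩; exact C.s1_t2 F
  t1_t2 := by rintro ⟨F⟩; exact C.t1_t2 F
  id1 := C.id1
  id2 := C.id2
  id3 := fun φ => Quotient.mk _ (C.id3 φ)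
  c11 := fun a b h => C.c11 a b h
  c12 := fun a b h => C.c12 a b h
  c21 := fun a b h => C.c21 a b h
  c13 := fun f => qlift (p := fun F => C.t0 f = C.s0 (C.s1 (qs2 hR F)))
    (fun F h => Quotient.mk _ (C.c13 f F h)) fun _ _ e _ _ => Quotient.sound (Cong.c13 f _ _ e)
  c31 := fun F f => qlift (p := fun F => C.t0 (C.s1 (qs2 hR F)) = C.s0 f)
    (fun F h => Quotient.mk _ (C.c31 F f h)) (fun _ _ e _ _ => Quotient.sound (Cong.c31 f _ _ e)) F
  c22 := fun a b h => C.c22 a b h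
  c23 := fun φ => qlift (p := fun F => C.t1 φ = C.s1 (qs2 hR F))
    (fun F h => Quotient.mk _ (C.c23 φ F h)) fun _ _ e _ _ => Quotient.sound (Cong.c23 φ _ _ e)
  c32 := fun F φ => qlift (p := fun F => C.t1 (qs2 hR F) = C.s1 φ)
    (fun F h => Quotient.mk _ (C.c32 F φ h)) (fun _ _ e _ _ => Quotient.sound (Cong.c32 φ _ _ e)) F
  c33 := fun F G => qlift (p := fun F => qt2 hR F = qs2 hR G)
    (fun F => qlift (p := fun G => C.t2 F = qs2 hR G)
      (fun G h => Quotient.mk _ (C.c33 F G h))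
      (fun _ _ e _ _ => Quotient.sound (Cong.c33 _ _ (.refl F) e)) G)
    (fun F F' e h h' => by
      induction G using Quotient.inductionOn with
      | h G => exact Quotient.sound (Cong.c33 h h' e (.refl G))) F
  s0_id1 := C.s0_id1
  t0_id1 := C.t0_id1
  s1_id2 := C.s1_id2
  t1_id2 := C.t1_id2
  s2_id3 := C.s2_id3
  t2_id3 := C.t2_id3
  s0_c11 := C.s0_c11
  t0_c11 := C.t0_c11
  s1_c12 := C.s1_c12
  t1_c12 := C.t1_c12
  s1_c21 := C.s1_c21
  t1_c21 := C.t1_c21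
  s2_c13 := by
    intro a b
    induction b using Quotient.inductionOn
    exact C.s2_c13 _ _
  t2_c13 := by
    intro a b
    induction b using Quotient.inductionOn
    exact C.t2_c13 _ _
  s2_c31 := by
    intro a b
    induction a using Quotient.inductionOn
    exact C.s2_c31 _ _
  t2_c31 := by
    intro a b
    induction a using Quotient.inductionOn
    exact C.t2_c31 _ _
  s1_c22 := C.s1_c22
  t1_c22 := C.t1_c22
  s2_c23 := by
    intro a b
    induction b using Quotient.inductionOn
    exact C.s2_c23 _ _
  t2_c23 := by
    intro a b
    induction b using Quotient.inductionOn
    exact C.t2_c23 _ _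
  s2_c32 := by
    intro a b
    induction a using Quotient.inductionOn
    exact C.s2_c32 _ _
  t2_c32 := by
    intro a b
    induction a using Quotient.inductionOn
    exact C.t2_c32 _ _
  s2_c33 := by
    intro a b
    induction a using Quotient.inductionOn
    induction b using Quotient.inductionOn
    exact C.s2_c33 _ _
  t2_c33 := by
    intro a b
    induction a using Quotient.inductionOn
    induction b using Quotient.inductionOn
    exact C.t2_c33 _ _

/-- The class of a 3-cell in the quotient. -/
def qmk (F : C.C3) : (quotientData hR).C3 := Quotient.mk (congSetoid C R) F

theorem qmk_surjective (F : (quotientData hR).C3) : ∃ F', qmk hR F' = F :=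
  Quotient.exists_rep F

theorem qmk_eq_iff {F G : C.C3} : qmk hR F = qmk hR G ↔ Cong C R F G :=
  Quotient.eq

theorem qmk_c13 (f : C.C1) (F : C.C3) (h) :
    (quotientData hR).c13 f (qmk hR F) h = qmk hR (C.c13 f F h) :=
  rfl
theorem qmk_c31 (F : C.C3) (f : C.C1) (h) :
    (quotientData hR).c31 (qmk hR F) f h = qmk hR (C.c31 F f h) :=
  rfl
theorem qmk_c23 (φ : C.C2) (F : C.C3) (h) :
    (quotientData hR).c23 φ (qmk hR F) h = qmk hR (C.c23 φ F h) :=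
  rfl
theorem qmk_c32 (F : C.C3) (φ : C.C2) (h) :
    (quotientData hR).c32 (qmk hR F) φ h = qmk hR (C.c32 F φ h) :=
  rfl
theorem qmk_c33 (F G : C.C3) (h) :
    (quotientData hR).c33 (qmk hR F) (qmk hR G) h = qmk hR (C.c33 F G h) :=
  rfl

theorem quotient_unitLaws : UnitLaws (quotientData hR) where
  id_c11 := C.unit_laws.id_c11
  id_c12 := C.unit_laws.id_c12
  id_c13 := by
    intro F
    obtain ⟨F, rfl⟩ := qmk_surjective hR F
    exact congrArg (qmk hR) (C.unit_laws.id_c13 F)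
  id_c22 := C.unit_laws.id_c22
  id_c23 := by
    intro F
    obtain ⟨F, rfl⟩ := qmk_surjective hR F
    exact congrArg (qmk hR) (C.unit_laws.id_c23 F)
  id_c33 := by
    intro F
    obtain ⟨F, rfl⟩ := qmk_surjective hR F
    exact congrArg (qmk hR) (C.unit_laws.id_c33 F)
  id_c21 := C.unit_laws.id_c21
  id_c31 := fun a b h => congrArg (qmk hR) (C.unit_laws.id_c31 a b h)
  id_c32 := fun a b h => congrArg (qmk hR) (C.unit_laws.id_c32 a b h)
  c11_id := C.unit_laws.c11_id
  c21_id := C.unit_laws.c21_id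
  c31_id := by
    intro F
    obtain ⟨F, rfl⟩ := qmk_surjective hR F
    exact congrArg (qmk hR) (C.unit_laws.c31_id F)
  c22_id := C.unit_laws.c22_id
  c32_id := by
    intro F
    obtain ⟨F, rfl⟩ := qmk_surjective hR F
    exact congrArg (qmk hR) (C.unit_laws.c32_id F)
  c33_id := by
    intro F
    obtain ⟨F, rfl⟩ := qmk_surjective hR F
    exact congrArg (qmk hR) (C.unit_laws.c33_id F)
  c12_id := C.unit_laws.c12_id
  c13_id := fun a b h => congrArg (qmk hR) (C.unit_laws.c13_id a b h)
  c23_id := fun a b h => congrArg (qmk hR) (C.unit_laws.c23_id a b h)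

theorem quotient_assocLaws : AssocLaws (quotientData hR) where
  assoc111 := C.assoc_laws.assoc111
  assoc112 := C.assoc_laws.assoc112
  assoc121 := C.assoc_laws.assoc121
  assoc211 := C.assoc_laws.assoc211
  assoc113 := by
    intro a b c h h'
    obtain ⟨c, rfl⟩ := qmk_surjective hR c
    exact congrArg (qmk hR) (C.assoc_laws.assoc113 a b c h h')
  assoc131 := by
    intro a b c h h'
    obtain ⟨b, rfl⟩ := qmk_surjective hR b
    exact congrArg (qmk hR) (C.assoc_laws.assoc131 a b c h h')
  assoc311 := by
    intro a b c h h'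
    obtain ⟨a, rfl⟩ := qmk_surjective hR a
    exact congrArg (qmk hR) (C.assoc_laws.assoc311 a b c h h')
  assoc222 := C.assoc_laws.assoc222
  assoc223 := by
    intro a b c h h'
    obtain ⟨c, rfl⟩ := qmk_surjective hR c
    exact congrArg (qmk hR) (C.assoc_laws.assoc223 a b c h h')
  assoc232 := by
    intro a b c h h'
    obtain ⟨b, rfl⟩ := qmk_surjective hR b
    exact congrArg (qmk hR) (C.assoc_laws.assoc232 a b c h h')
  assoc322 := by
    intro a b c h h'
    obtain ⟨a, rfl⟩ := qmk_surjective hR a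
    exact congrArg (qmk hR) (C.assoc_laws.assoc322 a b c h h')
  assoc333 := by
    intro a b c h h'
    obtain ⟨a, rfl⟩ := qmk_surjective hR a
    obtain ⟨b, rfl⟩ := qmk_surjective hR b
    obtain ⟨c, rfl⟩ := qmk_surjective hR c
    exact congrArg (qmk hR) (C.assoc_laws.assoc333 a b c h h')

theorem quotient_distribLaws : DistribLaws (quotientData hR) where
  distrib1_22 := C.distrib_laws.distrib1_22
  distrib1_23 := by
    intro a b c h h'
    obtain ⟨c, rfl⟩ := qmk_surjective hR c
    exact congrArg (qmk hR) (C.distrib_laws.distrib1_23 a b c h h')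
  distrib1_32 := by
    intro a b c h h'
    obtain ⟨b, rfl⟩ := qmk_surjective hR b
    exact congrArg (qmk hR) (C.distrib_laws.distrib1_32 a b c h h')
  distrib1_33 := by
    intro a b c h h'
    obtain ⟨b, rfl⟩ := qmk_surjective hR b
    obtain ⟨c, rfl⟩ := qmk_surjective hR c
    exact congrArg (qmk hR) (C.distrib_laws.distrib1_33 a b c h h')
  distrib2_33 := by
    intro a b c h h'
    obtain ⟨b, rfl⟩ := qmk_surjective hR b
    obtain ⟨c, rfl⟩ := qmk_surjective hR c
    exact congrArg (qmk hR) (C.distrib_laws.distrib2_33 a b c h h')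
  distrib22_1 := C.distrib_laws.distrib22_1
  distrib23_1 := by
    intro a b c h h'
    obtain ⟨b, rfl⟩ := qmk_surjective hR b
    exact congrArg (qmk hR) (C.distrib_laws.distrib23_1 a b c h h')
  distrib32_1 := by
    intro a b c h h'
    obtain ⟨a, rfl⟩ := qmk_surjective hR a
    exact congrArg (qmk hR) (C.distrib_laws.distrib32_1 a b c h h')
  distrib33_1 := by
    intro a b c h h'
    obtain ⟨a, rfl⟩ := qmk_surjective hR a
    obtain ⟨b, rfl⟩ := qmk_surjective hR b
    exact congrArg (qmk hR) (C.distrib_laws.distrib33_1 a b c h h')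
  distrib33_2 := by
    intro a b c h h'
    obtain ⟨a, rfl⟩ := qmk_surjective hR a
    obtain ⟨b, rfl⟩ := qmk_surjective hR b
    exact congrArg (qmk hR) (C.distrib_laws.distrib33_2 a b c h h')

end

/-- The quotient of a 3-precategory by the smallest congruence on 3-cells containing `R`. -/
def quotient (C : Precategory3.{u}) (R : C.C3 → C.C3 → Prop)
    (hR : C.IsParallel R) : Precategory3.{u} where
  toPrecategoryData3 := quotientData hR
  unit_laws := quotient_unitLaws hR
  assoc_laws := quotient_assocLaws hR
  distrib_laws := quotient_distribLaws hR

end Precategory3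

/-! ### Prefixes and suffixes of formal composites -/

namespace FreeCell

variable {V E : Type u} {s t : E → V}

theorem linked_take_drop (c : FreeCell s t) (n : ℕ) :
    Linked s t c.src (c.steps.take n) ∧
      Linked s t (endpoint t c.src (c.steps.take n)) (c.steps.drop n) := by
  rw [← linked_append, List.take_append_drop]
  exact c.linked

/-- The composite of the first `n` steps. -/
@[simps] def take (c : FreeCell s t) (n : ℕ) : FreeCell s t :=
  ⟨c.src, c.steps.take n, (c.linked_take_drop n).1⟩

/-- The composite of all steps but the first `n`. -/
@[simps] def drop (c : FreeCell s t) (n : ℕ) : FreeCell s t :=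
  ⟨(c.take n).tgt, c.steps.drop n, (c.linked_take_drop n).2⟩

@[simp] theorem tgt_drop (c : FreeCell s t) (n : ℕ) : (c.drop n).tgt = c.tgt := by
  have h : c.tgt = endpoint t c.src (c.steps.take n ++ c.steps.drop n) := by
    rw [List.take_append_drop]; rfl
  rw [h, endpoint_append]
  rfl

@[simp] theorem take_zero (c : FreeCell s t) : c.take 0 = nil s t c.src := rfl

@[simp] theorem drop_zero (c : FreeCell s t) : c.drop 0 = c := FreeCell.ext rfl rfl

@[simp] theorem take_length (c : FreeCell s t) : c.take c.steps.length = c :=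
  FreeCell.ext rfl List.take_length

@[simp] theorem drop_length (c : FreeCell s t) : c.drop c.steps.length = nil s t c.tgt :=
  FreeCell.ext (by simp) (by simp)

theorem src_getElem (c : FreeCell s t) (n : ℕ) (h : n < c.steps.length) :
    s c.steps[n] = (c.take n).tgt := by
  have := (c.linked_take_drop n).2
  rw [List.drop_eq_getElem_cons h] at this
  exact this.1

theorem take_succ (c : FreeCell s t) (n : ℕ) (h : n < c.steps.length) :
    c.take (n + 1) = (c.take n).comp (single s t c.steps[n]) (by simp [c.src_getElem n h]) :=
  FreeCell.ext rfl (by simp)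

theorem tgt_take_succ (c : FreeCell s t) (n : ℕ) (h : n < c.steps.length) :
    (c.take (n + 1)).tgt = t c.steps[n] := by
  simp [c.take_succ n h]

theorem drop_eq (c : FreeCell s t) (n : ℕ) (h : n < c.steps.length) :
    c.drop n = (single s t c.steps[n]).comp (c.drop (n + 1)) (by simp [c.tgt_take_succ n h]) :=
  FreeCell.ext (by simp [c.src_getElem n h]) (by simp)

end FreeCell

/-! ### Interchange cells -/

namespace Prepolygraph3

open Prepolygraph2 (genCell2)
open Prepolygraph2.Cell2 (lw rw)

/-- A family of interchange generators: for all 0-composable `α : f ⇒ f'`, `g`, `β : h ⇒ h'` with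
`α`, `β` 2-generators and `g` a 1-cell, a 3-generator
`X_{α,g,β} : (α ∘₀ g ∘₀ h) ∘₁ (f' ∘₀ g ∘₀ β) ⇛ (f ∘₀ g ∘₀ β) ∘₁ (α ∘₀ g ∘₀ h')`. -/
structure InterchangeGenerators (P : Prepolygraph3.{u}) where
  gen : ∀ (α : P.P2) (g : P.Cell1) (β : P.P2), (P.s1 α).tgt = g.src → g.tgt = (P.s1 β).src → P.P3
  s2_gen : ∀ α g β (h : (P.s1 α).tgt = g.src) (h' : g.tgt = (P.s1 β).src),
    P.s2 (gen α g β h h') =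
      FreeCell.comp (rw (genCell2 α) (g.comp (P.s1 β) h') (by simpa using h))
        (lw ((P.t1 α).comp g (by simpa using h)) (genCell2 β) (by simpa using h')) (by simp)
  t2_gen : ∀ α g β (h : (P.s1 α).tgt = g.src) (h' : g.tgt = (P.s1 β).src),
    P.t2 (gen α g β h h') =
      FreeCell.comp (lw ((P.s1 α).comp g h) (genCell2 β) (by simpa using h'))
        (rw (genCell2 α) (g.comp (P.t1 β) (by simpa using h')) (by simpa using h)) (by simp)

variable {P : Prepolygraph3.{u}}

theorem single_eq (w : P.Whisker2) : FreeCell.single _ _ w =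
    rw (lw w.l (genCell2 w.gen) (by simp [w.hl])) w.r (by simp [w.hr]) :=
  FreeCell.ext (by simp [Prepolygraph2.Whisker2.src])
    (by simp [genCell2, lw, rw, Prepolygraph2.Whisker2.lw, Prepolygraph2.Whisker2.rw])

theorem swap_composable (φ ψ : P.Cell2) (h : φ.src.tgt = ψ.src.src) (p q : ℕ) : (φ.take p).tgt.tgt = (ψ.take q).tgt.src := by
  simpa using h

variable (X : InterchangeGenerators P) (φ ψ : P.Cell2) (h : φ.src.tgt = ψ.src.src)

/-- Write `φ = φ_0 ∘₁ ... ∘₁ φ_{k-1}` and `ψ = ψ_0 ∘₁ ... ∘₁ ψ_{m-1}` as composites of whiskers,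
with `φ_p = f_p ∘₀ α_p ∘₀ g_p` and `ψ_q = f'_q ∘₀ β_q ∘₀ g'_q`.  This is the elementary exchange
of `φ_p` and `ψ_q`, in the context where the whiskers `φ_0, ..., φ_{p-1}, ψ_0, ..., ψ_{q-1}` occur
before them and `ψ_{q+1}, ..., ψ_{m-1}, φ_{p+1}, ..., φ_{k-1}` occur after them, in these orders;
its core is `f_p ∘₀ X_{α_p, g_p ∘₀ f'_q, β_q} ∘₀ g'_q`. -/
def swap (p q : ℕ) (hp : p < φ.steps.length) (hq : q < ψ.steps.length) : P.Whisker3 where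
  lam := FreeCell.comp (rw (φ.take p) ψ.src (by simpa using h))
    (lw (φ.take p).tgt (ψ.take q) (by simpa using h)) (by simp)
  l := φ.steps[p].l
  gen := X.gen φ.steps[p].gen
    (φ.steps[p].r.comp ψ.steps[q].l (by
      have := swap_composable φ ψ h p q
      rw [← φ.src_getElem p hp, ← ψ.src_getElem q hq] at this
      simpa using this))
    ψ.steps[q].gen (by simp [φ.steps[p].hr]) (by simp [ψ.steps[q].hl])
  r := ψ.steps[q].r
  rho := FreeCell.comp
    (lw (φ.take (p + 1)).tgt (ψ.drop (q + 1)) (by simpa using h))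
    (rw (φ.drop (p + 1)) ψ.tgt (by simpa using h)) (by simp)
  hl := by simp [X.s2_gen, φ.steps[p].hl]
  hr := by simp [X.s2_gen, ψ.steps[q].hr]
  hlam := by
    simp [X.s2_gen, ← φ.src_getElem p hp, ← ψ.src_getElem q hq, Prepolygraph2.Whisker2.src]
  hrho := by
    simp [X.s2_gen, φ.tgt_take_succ p hp, ψ.tgt_take_succ q hq, Prepolygraph2.Whisker2.tgt]

/-- The 2-cell obtained from `φ` and `ψ` by taking the whiskers in the order
`φ_0, ..., φ_{p-1}, ψ_0, ..., ψ_{q-1}, φ_p, ψ_q, ..., ψ_{m-1}, φ_{p+1}, ..., φ_{k-1}`. -/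
def shuffle (p q : ℕ) (hp : p < φ.steps.length) : P.Cell2 :=
  FreeCell.comp (rw (φ.take p) ψ.src (by simpa using h))
    (FreeCell.comp (lw (φ.take p).tgt (ψ.take q) (by simpa using h))
      (FreeCell.comp (rw (FreeCell.single _ _ φ.steps[p]) (ψ.take q).tgt
          (by simp [φ.src_getElem p hp, h]))
        (FreeCell.comp (lw (φ.take (p + 1)).tgt (ψ.drop q) (by simpa using h))
          (rw (φ.drop (p + 1)) ψ.tgt (by simpa using h)) (by simp))
        (by simp [φ.tgt_take_succ p hp]))
      (by simp [φ.src_getElem p hp]))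
    (by simp)

/-- The 2-cell obtained from `φ` and `ψ` by taking the whiskers in the order
`φ_0, ..., φ_{p-1}, ψ_0, ..., ψ_{m-1}, φ_p, ..., φ_{k-1}`. -/
def shuffle' (p : ℕ) : P.Cell2 :=
  FreeCell.comp (rw (φ.take p) ψ.src (by simpa using h))
    (FreeCell.comp (lw (φ.take p).tgt ψ (by simpa using h))
      (rw (φ.drop p) ψ.tgt (by simpa using h)) (by simp)) (by simp)

theorem src_swap (p q : ℕ) (hp : p < φ.steps.length) (hq : q < ψ.steps.length) :
    (swap X φ ψ h p q hp hq).src = shuffle φ ψ h p q hp := by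
  simp [swap, shuffle, Whisker3.src, X.s2_gen, ψ.drop_eq q hq, single_eq,
    φ.tgt_take_succ p hp, ← ψ.src_getElem q hq,
    Prepolygraph2.Whisker2.src, Prepolygraph2.Whisker2.tgt]

theorem tgt_swap (p q : ℕ) (hp : p < φ.steps.length) (hq : q < ψ.steps.length) :
    (swap X φ ψ h p q hp hq).tgt = shuffle φ ψ h p (q + 1) hp := by
  simp [swap, shuffle, Whisker3.tgt, X.t2_gen, ψ.take_succ q hq, single_eq,
    φ.tgt_take_succ p hp, ← φ.src_getElem p hp,
    Prepolygraph2.Whisker2.src, Prepolygraph2.Whisker2.tgt]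

theorem shuffle_zero (p : ℕ) (hp : p < φ.steps.length) :
    shuffle φ ψ h p 0 hp = shuffle' φ ψ h (p + 1) := by
  simp [shuffle, shuffle', φ.take_succ p hp]

theorem shuffle_length (p : ℕ) (hp : p < φ.steps.length) :
    shuffle φ ψ h p ψ.steps.length hp = shuffle' φ ψ h p := by
  simp [shuffle, shuffle', φ.drop_eq p hp]

/-- The exchange of `φ_p` with `ψ_0, ..., ψ_{q-1}` successively, in this order. -/
def row (p : ℕ) (hp : p < φ.steps.length) : (q : ℕ) → q ≤ ψ.steps.length →
    {F : P.Cell3 // F.src = shuffle φ ψ h p 0 hp ∧ F.tgt = shuffle φ ψ h p q hp}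
  | 0, _ => ⟨FreeCell.nil _ _ (shuffle φ ψ h p 0 hp), by simp⟩
  | q + 1, hq =>
    let F := row p hp q (Nat.le_of_succ_le hq)
    ⟨F.1.comp (FreeCell.single _ _ (swap X φ ψ h p q hp hq)) (by simp [F.2.2, src_swap]), by
      simp [F.2.1, tgt_swap]⟩

/-- The exchange of `φ_{p-1}`, then `φ_{p-2}`, ..., then `φ_0`, with all the whiskers of `ψ`. -/
def rows : (p : ℕ) → p ≤ φ.steps.length →
    {F : P.Cell3 // F.src = shuffle' φ ψ h p ∧ F.tgt = shuffle' φ ψ h 0}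
  | 0, _ => ⟨FreeCell.nil _ _ (shuffle' φ ψ h 0), by simp⟩
  | p + 1, hp =>
    let F := row X φ ψ h p hp ψ.steps.length le_rfl
    let G := rows p (Nat.le_of_succ_le hp)
    ⟨F.1.comp G.1 (by simp [F.2.2, G.2.1, shuffle_length]), by
      simp [F.2.1, G.2.2, shuffle_zero]⟩

/-- The 3-cell `X_{φ,ψ}`: the composite of the `k * m` elementary exchanges which move the last
whisker of `φ` past the whiskers of `ψ` from first to last, then the previous whisker of `φ`, and
so on until the first one. -/
def interchange : P.Cell3 := (rows X φ ψ h φ.steps.length le_rfl).1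

theorem src_interchange : (interchange X φ ψ h).src =
    FreeCell.comp (rw φ ψ.src h) (lw φ.tgt ψ (by simpa using h)) (by simp) := by
  simp [interchange, (rows X φ ψ h φ.steps.length le_rfl).2.1, shuffle']

theorem tgt_interchange : (interchange X φ ψ h).tgt =
    FreeCell.comp (lw φ.src ψ h) (rw φ ψ.tgt (by simpa using h)) (by simp) := by
  simp [interchange, (rows X φ ψ h φ.steps.length le_rfl).2.2, shuffle']

/-- The interchangers of the generated 3-precategory which are determined by a family of
interchange generators. -/
def freeInterchanger : Interchanger P.free where
  X := interchange X
  s2_X := src_interchange X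
  t2_X := tgt_interchange X

end Prepolygraph3

/-! ### Gray presentations -/

/-- A 4-prepolygraph: a 3-prepolygraph with a set of 4-generators between parallel 3-cells. -/
structure Prepolygraph4 extends Prepolygraph3.{u} where
  P4 : Type u
  s3 : P4 → toPrepolygraph3.Cell3
  t3 : P4 → toPrepolygraph3.Cell3
  src_t3 : ∀ Γ, (t3 Γ).src = (s3 Γ).src
  tgt_t3 : ∀ Γ, (t3 Γ).tgt = (s3 Γ).tgt

/-- The 3-precategory presented by a 4-prepolygraph: the quotient of the generated 3-precategory by
the smallest congruence identifying the source and the target of each 4-generator. -/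
def Prepolygraph4.presented (P : Prepolygraph4.{u}) : Precategory3.{u} :=
  P.free.quotient (fun F G => ∃ Γ : P.P4, P.s3 Γ = F ∧ P.t3 Γ = G) (by
    rintro _ _ ⟨Γ, rfl, rfl⟩
    exact ⟨(P.src_t3 Γ).symm, (P.tgt_t3 Γ).symm⟩)

/-- Two 3-generators `A : φ ⇛ φ' : f ⇒ g` and `B : ψ ⇛ ψ' : f' ⇒ g'`, 1-cells `e, h` and `e', h'`
such that `e ∘₀ A ∘₀ h` and `e' ∘₀ B ∘₀ h'` are defined, and a 2-cell
`χ : e ∘₀ g ∘₀ h ⇒ e' ∘₀ f' ∘₀ h'`. -/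
structure IndependenceConfig (P : Prepolygraph3.{u}) where
  A : P.P3
  B : P.P3
  e : P.Cell1
  h : P.Cell1
  e' : P.Cell1
  h' : P.Cell1
  χ : P.Cell2
  tgt_e : e.tgt = (P.s2 A).src.src
  src_h : (P.s2 A).src.tgt = h.src
  tgt_eB : e'.tgt = (P.s2 B).src.src
  src_hB : (P.s2 B).src.tgt = h'.src
  src_χ : (e.comp (P.s2 A).tgt (by simp [tgt_e])).comp h (by simp [src_h]) = χ.src
  tgt_χ : χ.tgt = (e'.comp (P.s2 B).src (by simp [tgt_eB])).comp h' (by simp [src_hB])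

namespace IndependenceConfig

open Prepolygraph2.Cell2 (lw rw)
open Prepolygraph3 (genCell3)
open Prepolygraph3.Cell3 (lw0 rw0 lw1 rw1)

variable {P : Prepolygraph3.{u}} (c : IndependenceConfig P)

/-- `e ∘₀ φ ∘₀ h` -/
def φ : P.Cell2 := rw (lw c.e (P.s2 c.A) c.tgt_e) c.h (by simp [c.src_h])
/-- `e ∘₀ φ' ∘₀ h` -/
def φ' : P.Cell2 := rw (lw c.e (P.t2 c.A) (by simp [c.tgt_e])) c.h (by simp [c.src_h])
/-- `e' ∘₀ ψ ∘₀ h'` -/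
def ψ : P.Cell2 := rw (lw c.e' (P.s2 c.B) c.tgt_eB) c.h' (by simp [c.src_hB])
/-- `e' ∘₀ ψ' ∘₀ h'` -/
def ψ' : P.Cell2 := rw (lw c.e' (P.t2 c.B) (by simp [c.tgt_eB])) c.h' (by simp [c.src_hB])
/-- `e ∘₀ A ∘₀ h` -/
def cellA : P.Cell3 := rw0 (lw0 c.e (genCell3 c.A) (by simp [c.tgt_e])) c.h (by simp [c.src_h])
/-- `e' ∘₀ B ∘₀ h'` -/
def cellB : P.Cell3 := rw0 (lw0 c.e' (genCell3 c.B) (by simp [c.tgt_eB])) c.h' (by simp [c.src_hB])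

@[simp] theorem src_cellA : c.cellA.src = c.φ := by simp [cellA, φ]
@[simp] theorem tgt_cellA : c.cellA.tgt = c.φ' := by simp [cellA, φ']
@[simp] theorem src_cellB : c.cellB.src = c.ψ := by simp [cellB, ψ]
@[simp] theorem tgt_cellB : c.cellB.tgt = c.ψ' := by simp [cellB, ψ']
@[simp] theorem tgt_φ : c.φ.tgt = c.χ.src := by simp [φ, ← c.src_χ]
@[simp] theorem tgt_φ' : c.φ'.tgt = c.χ.src := by simp [φ', ← c.src_χ]
@[simp] theorem src_ψ : c.ψ.src = c.χ.tgt := by simp [ψ, c.tgt_χ]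
@[simp] theorem src_ψ' : c.ψ'.src = c.χ.tgt := by simp [ψ', c.tgt_χ]

/-- The 3-cell
`((e ∘₀ A ∘₀ h) ∘₁ χ ∘₁ (e' ∘₀ ψ ∘₀ h')) ∘₂ ((e ∘₀ φ' ∘₀ h) ∘₁ χ ∘₁ (e' ∘₀ B ∘₀ h'))`. -/
def Γ : P.Cell3 :=
  FreeCell.comp (rw1 (rw1 c.cellA c.χ (by simp)) c.ψ (by simp))
    (lw1 (c.φ'.comp c.χ (by simp)) c.cellB (by simp)) (by simp)

/-- The 3-cell
`((e ∘₀ φ ∘₀ h) ∘₁ χ ∘₁ (e' ∘₀ B ∘₀ h')) ∘₂ ((e ∘₀ A ∘₀ h) ∘₁ χ ∘₁ (e' ∘₀ ψ' ∘₀ h'))`. -/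
def Δ : P.Cell3 :=
  FreeCell.comp (lw1 (c.φ.comp c.χ (by simp)) c.cellB (by simp))
    (rw1 (rw1 c.cellA c.χ (by simp)) c.ψ' (by simp)) (by simp)

end IndependenceConfig

/-- A 3-generator `A : φ ⇛ φ' : f ⇒ f'`, a 1-cell `g` and a 2-generator `β : h ⇒ h'` which are
0-composable. -/
structure NaturalityConfigLeft (P : Prepolygraph3.{u}) where
  A : P.P3
  g : P.Cell1
  β : P.P2
  src_g : (P.s2 A).src.tgt = g.src
  tgt_g : g.tgt = (P.s1 β).src

namespace NaturalityConfigLeft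

open Prepolygraph2 (genCell2)
open Prepolygraph2.Cell2 (lw rw)
open Prepolygraph3 (genCell3)
open Prepolygraph3.Cell3 (lw0 rw0 lw1 rw1)

variable {P : Prepolygraph3.{u}} (X : Prepolygraph3.InterchangeGenerators P)
  (c : NaturalityConfigLeft P)

/-- `g ∘₀ β` -/
def ψ : P.Cell2 := lw c.g (genCell2 c.β) (by simp [c.tgt_g])

@[simp] theorem src_ψ : c.ψ.src = c.g.comp (P.s1 c.β) c.tgt_g := by simp [ψ]
@[simp] theorem tgt_ψ : c.ψ.tgt = c.g.comp (P.t1 c.β) (by simp [c.tgt_g]) := by simp [ψ]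

/-- The 3-cell `((A ∘₀ g ∘₀ h) ∘₁ (f' ∘₀ g ∘₀ β)) ∘₂ X_{φ', g ∘₀ β}`. -/
def Γ : P.Cell3 :=
  FreeCell.comp
    (rw1 (rw0 (genCell3 c.A) c.ψ.src (by simp [c.src_g])) (lw (P.s2 c.A).tgt c.ψ (by simp [c.src_g]))
      (by simp))
    (Prepolygraph3.interchange X (P.t2 c.A) c.ψ (by simp [c.src_g]))
    (by simp [Prepolygraph3.src_interchange])

/-- The 3-cell `X_{φ, g ∘₀ β} ∘₂ ((f ∘₀ g ∘₀ β) ∘₁ (A ∘₀ g ∘₀ h'))`. -/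
def Δ : P.Cell3 :=
  FreeCell.comp (Prepolygraph3.interchange X (P.s2 c.A) c.ψ (by simp [c.src_g]))
    (lw1 (lw (P.s2 c.A).src c.ψ (by simp [c.src_g])) (rw0 (genCell3 c.A) c.ψ.tgt (by simp [c.src_g]))
      (by simp))
    (by simp [Prepolygraph3.tgt_interchange])

end NaturalityConfigLeft

/-- A 2-generator `α : f ⇒ f'`, a 1-cell `g` and a 3-generator `B : ψ ⇛ ψ' : h ⇒ h'` which are
0-composable. -/
structure NaturalityConfigRight (P : Prepolygraph3.{u}) where
  α : P.P2
  g : P.Cell1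
  B : P.P3
  src_g : (P.s1 α).tgt = g.src
  tgt_g : g.tgt = (P.s2 B).src.src

namespace NaturalityConfigRight

open Prepolygraph2 (genCell2)
open Prepolygraph2.Cell2 (lw rw)
open Prepolygraph3 (genCell3)
open Prepolygraph3.Cell3 (lw0 rw0 lw1 rw1)

variable {P : Prepolygraph3.{u}} (X : Prepolygraph3.InterchangeGenerators P)
  (c : NaturalityConfigRight P)

/-- `α ∘₀ g` -/
def φ : P.Cell2 := rw (genCell2 c.α) c.g (by simp [c.src_g])

@[simp] theorem src_φ : c.φ.src = (P.s1 c.α).comp c.g c.src_g := by simp [φ]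
@[simp] theorem tgt_φ : c.φ.tgt = (P.t1 c.α).comp c.g (by simp [c.src_g]) := by simp [φ]

/-- The 3-cell `((α ∘₀ g ∘₀ h) ∘₁ (f' ∘₀ g ∘₀ B)) ∘₂ X_{α ∘₀ g, ψ'}`. -/
def Γ : P.Cell3 :=
  FreeCell.comp
    (lw1 (rw c.φ (P.s2 c.B).src (by simp [c.tgt_g])) (lw0 c.φ.tgt (genCell3 c.B) (by simp [c.tgt_g]))
      (by simp))
    (Prepolygraph3.interchange X c.φ (P.t2 c.B) (by simp [c.tgt_g]))
    (by simp [Prepolygraph3.src_interchange])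

/-- The 3-cell `X_{α ∘₀ g, ψ} ∘₂ ((f ∘₀ g ∘₀ B) ∘₁ (α ∘₀ g ∘₀ h'))`. -/
def Δ : P.Cell3 :=
  FreeCell.comp (Prepolygraph3.interchange X c.φ (P.s2 c.B) (by simp [c.tgt_g]))
    (rw1 (lw0 c.φ.src (genCell3 c.B) (by simp [c.tgt_g])) (rw c.φ (P.s2 c.B).tgt (by simp [c.tgt_g]))
      (by simp))
    (by simp [Prepolygraph3.tgt_interchange])

end NaturalityConfigRight

/-- A Gray presentation: a 4-prepolygraph with distinguished generators, namely interchange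
generators in dimension three, and independence generators `Γ ⟹ Δ` and both kinds of interchange
naturality generators `Γ ⟹ Δ` in dimension four.  It may have other generators. -/
structure GrayPresentation extends Prepolygraph4.{u} where
  X : Prepolygraph3.InterchangeGenerators toPrepolygraph3
  independence : IndependenceConfig toPrepolygraph3 → P4
  s3_independence : ∀ c, s3 (independence c) = c.Γ
  t3_independence : ∀ c, t3 (independence c) = c.Δ
  naturalityLeft : NaturalityConfigLeft toPrepolygraph3 → P4
  s3_naturalityLeft : ∀ c, s3 (naturalityLeft c) = c.Γ X
  t3_naturalityLeft : ∀ c, t3 (naturalityLeft c) = c.Δ X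
  naturalityRight : NaturalityConfigRight toPrepolygraph3 → P4
  s3_naturalityRight : ∀ c, s3 (naturalityRight c) = c.Γ X
  t3_naturalityRight : ∀ c, t3 (naturalityRight c) = c.Δ X

/-- The canonical interchangers of the presented 3-precategory: the classes of the 3-cells
`X_{φ,ψ}`. -/
def GrayPresentation.interchanger (P : GrayPresentation.{u}) : Interchanger P.presented where
  X φ ψ h := Precategory3.qmk _ (Prepolygraph3.interchange P.X φ ψ h)
  s2_X φ ψ h := Prepolygraph3.src_interchange P.X φ ψ h
  t2_X φ ψ h := Prepolygraph3.tgt_interchange P.X φ ψ h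

end GrayRewriting

/-! The cell $X_{\phi,\psi}$ is a $k\times m$ grid of elementary exchanges, traversed row by row:
the last whisker of $\phi$ crosses all of $\psi$, then the previous one does, up to the first. Most
interchanger axioms compare two ways of reading this grid and hold already in $P^*$, as equalities
of sequences of 3-whiskers. An empty grid is an identity (`interchange_nil_left`,
`interchange_nil_right`). Whiskering by a 1-cell changes only the outer 1-cells of each exchange, or
rebrackets the 1-cell between $\alpha_p$ and $\beta_q$ (`interchange_lw`, `interchange_rw`,
`interchange_middle`). Cutting $\phi$ cuts the grid between two rows, and hence cuts the sequence in
two (`interchange_comp_left`).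

Cutting $\psi$ is different. It cuts every row, and the pieces are not consecutive in the traversal.
Regrouping them requires commuting exchanges that act on disjoint parts of a 2-cell, so the axiom
for $\psi\circ_1\psi'$ holds only modulo the 4-generators (`interchange_comp_right`). The exchange
law must come first.

The exchange law for two elementary 3-cells is a whiskered independence generator, whose 2-cell
$\chi$ is whatever lies between the two 3-generators. Commuting squares paste along $\circ_2$ in
both variables, so the law extends to all 3-cells (`exchange`).

For naturality, the class of pairs ($A$, $\psi$) for which the square commutes is stable under every
operation that builds cells from generators: $\circ_2$-composition of $A$, $\circ_1$-composition of
$\psi$, and whiskering of either one. Stability follows from the interchanger axioms, together with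
the exchange law when $A$ is whiskered by a 2-cell. On generators the square is a 4-generator, so it
always commutes (`naturalLeft`). The second variable is treated in the same way (`naturalRight`). -/

namespace GrayRewriting

/-! ### Induction on formal composites, and prefixes and suffixes of a concatenation -/

namespace FreeCell

variable {V E : Type u} {s t : E → V}

/-- Induction on formal composites, adding steps at the front. -/
theorem cons_induction {motive : FreeCell s t → Prop} (nil : ∀ x, motive (FreeCell.nil s t x))
    (cons : ∀ (e : E) (c : FreeCell s t) (h : (single s t e).tgt = c.src), motive c →
      motive ((single s t e).comp c h)) (c : FreeCell s t) : motive c := by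
  obtain ⟨x, l, hl⟩ := c
  induction l generalizing x with
  | nil => exact nil x
  | cons e l ih =>
    obtain ⟨rfl, hl⟩ := hl
    exact cons e ⟨t e, l, hl⟩ (by simp) (ih _ hl)

/-- The composability proof depends on both factors, so composites are compared factor by factor
instead of by rewriting inside them. -/
theorem comp_congr {c c' d d' : FreeCell s t} (hc : c = c') (hd : d = d') (h) :
    c.comp d h = c'.comp d' (hc ▸ hd ▸ h) := by
  subst hc hd; rfl

@[simp] theorem take_single_one (e : E) : (single s t e).take 1 = single s t e := rfl

@[simp] theorem drop_single_one (e : E) : (single s t e).drop 1 = nil s t (t e) := rfl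

theorem take_comp_drop (c : FreeCell s t) (n : ℕ) (h : (c.take n).tgt = (c.drop n).src) :
    (c.take n).comp (c.drop n) h = c :=
  FreeCell.ext rfl (by simp)

theorem take_comp_left (c d : FreeCell s t) (h) (n : ℕ) (hn : n ≤ c.steps.length) :
    (c.comp d h).take n = c.take n :=
  FreeCell.ext rfl (by simp [List.take_append_of_le_length hn])

theorem take_comp_right (c d : FreeCell s t) (h) (n : ℕ) :
    (c.comp d h).take (c.steps.length + n) = c.comp (d.take n) (by simpa using h) :=
  FreeCell.ext rfl (by simp [List.take_append, List.take_of_length_le])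

theorem drop_comp_left (c d : FreeCell s t) (h) (n : ℕ) (hn : n ≤ c.steps.length) :
    (c.comp d h).drop n = (c.drop n).comp d (by simpa using h) :=
  FreeCell.ext (by simp [take_comp_left c d h n hn]) (by simp [List.drop_append_of_le_length hn])

theorem drop_comp_right (c d : FreeCell s t) (h) (n : ℕ) :
    (c.comp d h).drop (c.steps.length + n) = d.drop n :=
  FreeCell.ext (by simp [take_comp_right c d h n]) (by simp [List.drop_append])

end FreeCell

/-! ### Whiskering of 2-cells: steps, prefixes and suffixes -/

namespace Prepolygraph2.Whisker2

variable {P : Prepolygraph2.{u}}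

@[simp] theorem rw_rw (w : P.Whisker2) (f g : P.Cell1) (h h') :
    rw (rw w f h) g h' = rw w (f.comp g (by simpa using h')) (by simpa using h) := by
  apply Whisker2.ext <;> simp

@[simp] theorem rw_lw (f : P.Cell1) (w : P.Whisker2) (g : P.Cell1) (h h') :
    rw (lw f w h) g h' = lw f (rw w g (by simpa using h')) (by simpa using h) := by
  apply Whisker2.ext <;> simp

end Prepolygraph2.Whisker2

namespace Prepolygraph2.Cell2

variable {P : Prepolygraph2.{u}}

@[simp] theorem length_lw (f : P.Cell1) (φ : P.Cell2) (h) :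
    (lw f φ h).steps.length = φ.steps.length := by simp [lw]

@[simp] theorem length_rw (φ : P.Cell2) (f : P.Cell1) (h) :
    (rw φ f h).steps.length = φ.steps.length := by simp [rw]

/-- All whiskers of a 2-cell run between the same two 0-cells. Hence a 1-cell composable with `φ` is
composable with each whisker, which makes the formulas for the steps of `lw` and `rw` meaningful. -/
theorem getElem_src_src (φ : P.Cell2) (n : ℕ) (hn : n < φ.steps.length) :
    φ.steps[n].l.src = φ.src.src := by
  simpa using congrArg FreeCell.src (φ.src_getElem n hn)

theorem getElem_src_tgt (φ : P.Cell2) (n : ℕ) (hn : n < φ.steps.length) :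
    φ.steps[n].r.tgt = φ.src.tgt := by
  simpa using congrArg FreeCell.tgt (φ.src_getElem n hn)

@[simp] theorem getElem_lw (f : P.Cell1) (φ : P.Cell2) (h) (n : ℕ) (hn) :
    (lw f φ h).steps[n]'hn = (φ.steps[n]'(by simpa using hn)).lw f
      (by simpa [getElem_src_src] using h) := by simp [lw]

@[simp] theorem getElem_rw (φ : P.Cell2) (f : P.Cell1) (h) (n : ℕ) (hn) :
    (rw φ f h).steps[n]'hn = (φ.steps[n]'(by simpa using hn)).rw f
      (by simpa [getElem_src_tgt] using h) := by simp [rw]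

@[simp] theorem lw_single (f : P.Cell1) (w : P.Whisker2) (h) :
    lw f (FreeCell.single _ _ w) h = FreeCell.single _ _ (w.lw f (by simpa using h)) :=
  FreeCell.ext (by simp) (by simp [lw])

@[simp] theorem rw_single (w : P.Whisker2) (f : P.Cell1) (h) :
    rw (FreeCell.single _ _ w) f h = FreeCell.single _ _ (w.rw f (by simpa using h)) :=
  FreeCell.ext (by simp) (by simp [rw])

theorem take_lw (f : P.Cell1) (φ : P.Cell2) (h) (n : ℕ) :
    (lw f φ h).take n = lw f (φ.take n) (by simpa using h) :=
  FreeCell.ext_getElem (by simp) (by simp) fun i _ _ => by simp [lw]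

theorem take_rw (φ : P.Cell2) (f : P.Cell1) (h) (n : ℕ) :
    (rw φ f h).take n = rw (φ.take n) f (by simpa using h) :=
  FreeCell.ext_getElem (by simp) (by simp) fun i _ _ => by simp [rw]

theorem drop_lw (f : P.Cell1) (φ : P.Cell2) (h) (n : ℕ) :
    (lw f φ h).drop n = lw f (φ.drop n) (by simpa using h) :=
  FreeCell.ext_getElem (by simp [take_lw]) (by simp) fun i _ _ => by simp [lw]

theorem drop_rw (φ : P.Cell2) (f : P.Cell1) (h) (n : ℕ) :
    (rw φ f h).drop n = rw (φ.drop n) f (by simpa using h) :=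
  FreeCell.ext_getElem (by simp [take_rw]) (by simp) fun i _ _ => by simp [rw]

end Prepolygraph2.Cell2

/-! ### Whiskering of 3-cells with a single step -/

namespace Prepolygraph3.Cell3

variable {P : Prepolygraph3.{u}}

@[simp] theorem lw0_single (f : P.Cell1) (w : P.Whisker3) (h) :
    lw0 f (FreeCell.single _ _ w) h = FreeCell.single _ _ (w.lw0 f (by simpa using h)) :=
  FreeCell.ext (by simp) (by simp [lw0])

@[simp] theorem rw0_single (w : P.Whisker3) (f : P.Cell1) (h) :
    rw0 (FreeCell.single _ _ w) f h = FreeCell.single _ _ (w.rw0 f (by simpa using h)) :=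
  FreeCell.ext (by simp) (by simp [rw0])

@[simp] theorem lw1_single (φ : P.Cell2) (w : P.Whisker3) (h) :
    lw1 φ (FreeCell.single _ _ w) h = FreeCell.single _ _ (w.lw1 φ (by simpa using h)) :=
  FreeCell.ext (by simp) (by simp [lw1])

@[simp] theorem rw1_single (w : P.Whisker3) (φ : P.Cell2) (h) :
    rw1 (FreeCell.single _ _ w) φ h = FreeCell.single _ _ (w.rw1 φ (by simpa using h)) :=
  FreeCell.ext (by simp) (by simp [rw1])

end Prepolygraph3.Cell3

namespace Prepolygraph3

open Prepolygraph2.Cell2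
open Cell3 (lw0 rw0 lw1 rw1)

variable {P : Prepolygraph3.{u}} (X : InterchangeGenerators P)

attribute [local simp] src_interchange tgt_interchange

/-! #### Strict laws of the interchange cells -/

theorem row_congr (φ ψ : P.Cell2) (h p hp) {q q' : ℕ} (e : q = q') (hq hq') :
    (row X φ ψ h p hp q hq).1 = (row X φ ψ h p hp q' hq').1 := by
  subst e; rfl

/-- The number of rows is the length of `φ`, which for a whiskered or composite 2-cell agrees with
the convenient expression only up to a provable equality. This lemma, and `row_congr` for the length
of a row, absorb that difference. -/
theorem interchange_eq_rows (φ ψ : P.Cell2) (h) {n : ℕ} (e : n = φ.steps.length) :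
    interchange X φ ψ h = (rows X φ ψ h n e.le).1 := by
  subst e; rfl

theorem interchange_nil_left (f : P.Cell1) (ψ : P.Cell2) (h) :
    interchange X (FreeCell.nil _ _ f) ψ h = FreeCell.nil _ _ (lw f ψ (by simpa using h)) := by
  rw [interchange_eq_rows X _ ψ h (n := 0) rfl]
  simp [rows, shuffle']

theorem rows_nil_right (φ : P.Cell2) (g : P.Cell1) (h p hp) :
    (rows X φ (FreeCell.nil _ _ g) h p hp).1 =
      FreeCell.nil _ _ (rw φ g (by simpa using h)) := by
  induction p with
  | zero => simp [rows, shuffle']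
  | succ p ih =>
    simp only [rows]
    rw [FreeCell.comp_congr rfl (ih _)]
    -- The right-hand 2-cell has no whiskers, so each row has length zero and is an identity.
    show (row X φ _ h p hp 0 (Nat.zero_le _)).1 = _
    simp only [row, shuffle_zero, shuffle']
    -- The object of this identity is `φ` cut after its first `p + 1` whiskers; gluing the two
    -- pieces gives back the whole of `φ`, whiskered by `g`.
    have := rw_comp (φ.take (p + 1)) (φ.drop (p + 1)) g (by simp) (by simpa using h)
    simp only [FreeCell.take_comp_drop] at this
    simp [this]

theorem interchange_nil_right (φ : P.Cell2) (g : P.Cell1) (h) :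
    interchange X φ (FreeCell.nil _ _ g) h = FreeCell.nil _ _ (rw φ g (by simpa using h)) :=
  rows_nil_right ..

/-! ### Compatibility with whiskering by 1-cells -/

section WhiskerLeft

variable (e : P.Cell1) (φ ψ : P.Cell2) (he : e.tgt = φ.src.src) (h : φ.src.tgt = ψ.src.src) (h')

/-- Left whiskering extends only the outer 1-cell $f_p$; the generator depends on $\alpha_p$,
$g_p\circ_0f'_q$ and $\beta_q$, so it is literally the same one. -/
theorem swap_lw (p q hp hq hp' h'') :
    swap X (lw e φ he) ψ h' p q hp' hq = (swap X φ ψ h p q hp hq).lw0 e h'' := by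
  apply Whisker3.ext <;> simp [swap, take_lw, drop_lw]

theorem row_lw (p hp hp' q hq h'') :
    (row X (lw e φ he) ψ h' p hp' q hq).1 = lw0 e (row X φ ψ h p hp q hq).1 h'' := by
  induction q with
  | zero => simp [row, shuffle, take_lw, drop_lw]
  | succ q ih =>
    simp only [row, Cell3.lw0_comp, Cell3.lw0_single]
    exact FreeCell.comp_congr (ih _ _) (congrArg _ (swap_lw ..)) _

theorem rows_lw (p hp hp' h'') :
    (rows X (lw e φ he) ψ h' p hp').1 = lw0 e (rows X φ ψ h p hp).1 h'' := by
  induction p with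
  | zero => simp [rows, shuffle']
  | succ p ih =>
    simp only [rows, Cell3.lw0_comp]
    exact FreeCell.comp_congr (row_lw ..) (ih ..) _

theorem interchange_lw (h'') :
    interchange X (lw e φ he) ψ h' = lw0 e (interchange X φ ψ h) h'' := by
  rw [interchange_eq_rows X (lw e φ he) ψ _ (length_lw e φ he).symm]
  exact rows_lw ..

end WhiskerLeft

section WhiskerRight

variable (φ ψ : P.Cell2) (k : P.Cell1) (h : φ.src.tgt = ψ.src.src) (hk : ψ.src.tgt = k.src) (h')

/-- Here only the outer 1-cell $g'_q$ grows, and the interchange generator is again unchanged. -/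
theorem swap_rw (p q hp hq hq' h'') :
    swap X φ (rw ψ k hk) h' p q hp hq' = (swap X φ ψ h p q hp hq).rw0 k h'' := by
  apply Whisker3.ext <;> simp [swap, take_rw, drop_rw]

theorem row_rw (p hp q hq hq' h'') :
    (row X φ (rw ψ k hk) h' p hp q hq').1 = rw0 (row X φ ψ h p hp q hq).1 k h'' := by
  induction q with
  | zero => simp [row, shuffle]
  | succ q ih =>
    simp only [row, Cell3.rw0_comp, Cell3.rw0_single]
    exact FreeCell.comp_congr (ih ..) (congrArg _ (swap_rw ..)) _

theorem rows_rw (p hp h'') :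
    (rows X φ (rw ψ k hk) h' p hp).1 = rw0 (rows X φ ψ h p hp).1 k h'' := by
  induction p with
  | zero => simp [rows, shuffle']
  | succ p ih =>
    simp only [rows, Cell3.rw0_comp]
    -- A full row runs to the length of the whiskered 2-cell, so that bound is first replaced by the
    -- length of `ψ`.
    exact FreeCell.comp_congr ((row_congr X _ _ _ _ _ (length_rw ψ k hk) _ (by simp)).trans
      (row_rw ..)) (ih ..) _

theorem interchange_rw (h'') :
    interchange X φ (rw ψ k hk) h' = rw0 (interchange X φ ψ h) k h'' :=
  rows_rw ..

end WhiskerRight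

section WhiskerMiddle

variable (φ : P.Cell2) (f : P.Cell1) (ψ : P.Cell2) (h : φ.src.tgt = f.src) (hf : f.tgt = ψ.src.src)
  (h' h'')

/-- Both sides use the generator whose middle 1-cell is $g_p\circ_0f\circ_0f'_q$; the only
difference is the bracketing, and composition of 1-cells in $P^*$ is strictly associative. -/
theorem swap_middle (p q hp hq hp' hq') :
    swap X (rw φ f h) ψ h' p q hp hq = swap X φ (lw f ψ hf) h'' p q hp' hq' := by
  apply Whisker3.ext <;> simp [swap, take_rw, drop_rw, take_lw, drop_lw]

theorem row_middle (p hp hp' q hq hq') :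
    (row X (rw φ f h) ψ h' p hp q hq).1 = (row X φ (lw f ψ hf) h'' p hp' q hq').1 := by
  induction q with
  | zero => simp [row, shuffle, take_rw, drop_rw]
  | succ q ih =>
    simp only [row]
    exact FreeCell.comp_congr (ih ..) (congrArg _ (swap_middle ..)) _

theorem rows_middle (p hp hp') :
    (rows X (rw φ f h) ψ h' p hp).1 = (rows X φ (lw f ψ hf) h'' p hp').1 := by
  induction p with
  | zero => simp [rows, shuffle']
  | succ p ih =>
    simp only [rows]
    exact FreeCell.comp_congr (Eq.trans (row_middle (hq' := by simp) ..)
      (row_congr X _ _ _ _ _ (length_lw f ψ hf).symm _ _)) (ih ..) _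

theorem interchange_middle :
    interchange X (rw φ f h) ψ h' = interchange X φ (lw f ψ hf) h'' := by
  rw [interchange_eq_rows X (rw φ f h) ψ _ (length_rw φ f h).symm]
  exact rows_middle ..

end WhiskerMiddle

/-! ### Composition in the first variable -/

section CompLeft

variable (φ φ' ψ : P.Cell2) (h : φ.tgt = φ'.src) (h₁ : φ.src.tgt = ψ.src.src)
  (h₂ : φ'.src.tgt = ψ.src.src) (h')

/-- When a whisker of `φ` moves, all of `φ'` has already crossed `ψ`. It therefore stands at the
end, next to the target of `ψ`. -/
theorem swap_comp_left_of_lt (p q hp hq hp' h'') :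
    swap X (φ.comp φ' h) ψ h' p q hp' hq =
      (swap X φ ψ h₁ p q hp hq).rw1 (rw φ' ψ.tgt (by simpa using h₂)) h'' := by
  apply Whisker3.ext <;>
    simp [swap, φ.take_comp_left φ' h _ hp, φ.take_comp_left φ' h _ hp.le,
      φ.drop_comp_left φ' h _ hp, hp]

/-- When a whisker of `φ'` moves, `φ` has not moved yet. It stands at the beginning, next to the
source of `ψ`. -/
theorem swap_comp_left_of_ge (p q hp hq hp' h'') :
    swap X (φ.comp φ' h) ψ h' (φ.steps.length + p) q hp' hq =
      (swap X φ' ψ h₂ p q hp hq).lw1 (rw φ ψ.src (by simpa using h₁)) h'' := by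
  apply Whisker3.ext <;>
    simp [swap, φ.take_comp_right φ' h, φ.drop_comp_right φ' h, Nat.add_assoc]

theorem row_comp_left_of_lt (p hp hp' q hq h'') :
    (row X (φ.comp φ' h) ψ h' p hp' q hq).1 =
      rw1 (row X φ ψ h₁ p hp q hq).1 (rw φ' ψ.tgt (by simpa using h₂)) h'' := by
  induction q with
  | zero =>
    simp [row, shuffle, φ.take_comp_left φ' h _ hp, φ.take_comp_left φ' h _ hp.le,
      φ.drop_comp_left φ' h _ hp, hp]
  | succ q ih =>
    simp only [row, Cell3.rw1_comp, Cell3.rw1_single]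
    exact FreeCell.comp_congr (ih ..) (congrArg _ (swap_comp_left_of_lt (h₂ := h₂) ..)) _

theorem row_comp_left_of_ge (p hp hp' q hq h'') :
    (row X (φ.comp φ' h) ψ h' (φ.steps.length + p) hp' q hq).1 =
      lw1 (rw φ ψ.src (by simpa using h₁)) (row X φ' ψ h₂ p hp q hq).1 h'' := by
  induction q with
  | zero =>
    simp [row, shuffle, φ.take_comp_right φ' h, φ.drop_comp_right φ' h, Nat.add_assoc]
  | succ q ih =>
    simp only [row, Cell3.lw1_comp, Cell3.lw1_single]
    exact FreeCell.comp_congr (ih ..) (congrArg _ (swap_comp_left_of_ge (h₁ := h₁) ..)) _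

theorem rows_comp_left_of_le (p hp hp' h'') :
    (rows X (φ.comp φ' h) ψ h' p hp').1 =
      rw1 (rows X φ ψ h₁ p hp).1 (rw φ' ψ.tgt (by simpa using h₂)) h'' := by
  induction p with
  | zero => simp [rows, shuffle']
  | succ p ih =>
    simp only [rows, Cell3.rw1_comp]
    exact FreeCell.comp_congr (row_comp_left_of_lt (h₂ := h₂) ..) (ih ..) _

theorem rows_comp_left_of_ge (p hp hp' h₃ h₄ h₅) :
    (rows X (φ.comp φ' h) ψ h' (φ.steps.length + p) hp').1 =
      FreeCell.comp (lw1 (rw φ ψ.src (by simpa using h₁)) (rows X φ' ψ h₂ p hp).1 h₃)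
        (rw1 (interchange X φ ψ h₁) (rw φ' ψ.tgt (by simpa using h₂)) h₄) h₅ := by
  induction p with
  | zero =>
    -- At the junction no row of `φ'` is involved, and the rows of `φ` form the whole of its
    -- interchange cell.
    refine (rows_comp_left_of_le X φ φ' ψ h h₁ h₂ h' φ.steps.length le_rfl hp' h₄).trans ?_
    simp [rows, shuffle', interchange]
  | succ p ih =>
    simp only [rows, Cell3.lw1_comp, FreeCell.comp_assoc]
    exact FreeCell.comp_congr (row_comp_left_of_ge (h₁ := h₁) ..) (ih ..) _

/-- Rows run from the last whisker to the first, so those of `φ'` form an initial segment of the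
sequence and those of `φ` the remainder. The axiom thus holds as an equality in $P^*$. -/
theorem interchange_comp_left :
    interchange X (φ.comp φ' h) ψ h' =
      FreeCell.comp (lw1 (rw φ ψ.src (by simpa using h₁)) (interchange X φ' ψ h₂) (by simp [h]))
        (rw1 (interchange X φ ψ h₁) (rw φ' ψ.tgt (by simpa using h₂)) (by simp [h]))
        (by simp [h]) := by
  rw [interchange_eq_rows X (φ.comp φ' h) ψ _ (n := φ.steps.length + φ'.steps.length) (by simp)]
  exact rows_comp_left_of_ge ..

end CompLeft

/-! ### Composition in the second variable, for a single whisker on the left -/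

section CompRight

variable (w : P.Whisker2) (ψ ψ' : P.Cell2) (h : ψ.tgt = ψ'.src)
  (h₁ : (FreeCell.single _ _ w : P.Cell2).src.tgt = ψ.src.src)
  (h₂ : (FreeCell.single _ _ w : P.Cell2).src.tgt = ψ'.src.src) (h')

/-- While `w` crosses `ψ`, the 2-cell `ψ'` still comes after `w`, hence the whiskering by the target
of `w`. Once `w` has reached `ψ'`, all of `ψ` comes before it, next to the source of `w`. With a
single whisker, `p` must be `0` and no other part of the left-hand 2-cell enters the context. -/
theorem swap_comp_right_of_lt (p q hp hq hq' h'') :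
    swap X (FreeCell.single _ _ w) (ψ.comp ψ' h) h' p q hp hq' =
      (swap X (FreeCell.single _ _ w) ψ h₁ p q hp hq).rw1
        (lw w.tgt ψ' (by simpa using h₂)) h'' := by
  obtain rfl : p = 0 := by simpa using hp
  apply Whisker3.ext <;>
    simp [swap, ψ.take_comp_left ψ' h _ hq.le, ψ.drop_comp_left ψ' h _ hq, hq]

theorem swap_comp_right_of_ge (p q hp hq hq' h'') :
    swap X (FreeCell.single _ _ w) (ψ.comp ψ' h) h' p (ψ.steps.length + q) hp hq' =
      (swap X (FreeCell.single _ _ w) ψ' h₂ p q hp hq).lw1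
        (lw w.src ψ (by simpa using h₁)) h'' := by
  obtain rfl : p = 0 := by simpa using hp
  apply Whisker3.ext <;>
    simp [swap, ψ.take_comp_right ψ' h, ψ.drop_comp_right ψ' h, Nat.add_assoc]

theorem row_comp_right_of_le (p hp q hq hq' h'') :
    (row X (FreeCell.single _ _ w) (ψ.comp ψ' h) h' p hp q hq').1 =
      rw1 (row X (FreeCell.single _ _ w) ψ h₁ p hp q hq).1
        (lw w.tgt ψ' (by simpa using h₂)) h'' := by
  obtain rfl : p = 0 := by simpa using hp
  induction q with
  | zero => simp [row, shuffle]
  | succ q ih =>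
    simp only [row, Cell3.rw1_comp, Cell3.rw1_single]
    exact FreeCell.comp_congr (ih ..) (congrArg _ (swap_comp_right_of_lt (h₂ := h₂) ..)) _

theorem row_comp_right_of_ge (p hp q hq hq' h₃ h₄ h₅) :
    (row X (FreeCell.single _ _ w) (ψ.comp ψ' h) h' p hp (ψ.steps.length + q) hq').1 =
      FreeCell.comp (rw1 (row X (FreeCell.single _ _ w) ψ h₁ p hp ψ.steps.length le_rfl).1
          (lw w.tgt ψ' (by simpa using h₂)) h₃)
        (lw1 (lw w.src ψ (by simpa using h₁)) (row X (FreeCell.single _ _ w) ψ' h₂ p hp q hq).1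
          h₄) h₅ := by
  obtain rfl : p = 0 := by simpa using hp
  induction q with
  | zero =>
    refine (row_comp_right_of_le X w ψ ψ' h h₁ h₂ h' 0 hp _ le_rfl hq' h₃).trans ?_
    simp [row, shuffle]
  | succ q ih =>
    simp only [row, Cell3.lw1_comp, Cell3.lw1_single]
    -- A row grows at its end, so the new exchange must be reassociated into the second factor.
    refine (FreeCell.comp_congr (ih (by omega) (by simp; omega) (by simpa [row] using h₄) ?_)
      (congrArg _ (swap_comp_right_of_ge (h₁ := h₁) ..)) _).trans (FreeCell.comp_assoc ..)
    simp [(row X (FreeCell.single _ _ w) ψ h₁ 0 hp ψ.steps.length le_rfl).2.2,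
      (row X (FreeCell.single _ _ w) ψ' h₂ 0 hp q (by omega)).2.1, shuffle, h]

theorem interchange_single_left (h₁) :
    interchange X (FreeCell.single _ _ w) ψ h₁ =
      (row X (FreeCell.single _ _ w) ψ h₁ 0 (by simp) ψ.steps.length le_rfl).1 := by
  rw [interchange_eq_rows X _ ψ _ (n := 1) rfl]
  simp only [rows]
  exact FreeCell.comp_nil ..

/-- The grid has only one row, and cutting `ψ` cuts that row into two consecutive pieces. This is
the part of the axiom for $\psi\circ_1\psi'$ that needs no quotient. -/
theorem interchange_single_comp :
    interchange X (FreeCell.single _ _ w) (ψ.comp ψ' h) h' =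
      FreeCell.comp (rw1 (interchange X (FreeCell.single _ _ w) ψ h₁)
          (lw w.tgt ψ' (by simpa using h₂)) (by simp [h]))
        (lw1 (lw w.src ψ (by simpa using h₁)) (interchange X (FreeCell.single _ _ w) ψ' h₂)
          (by simp [h])) (by simp [h]) := by
  simp only [interchange_single_left]
  exact (row_congr X _ _ _ _ _ (by simp) _ (by simp)).trans (row_comp_right_of_ge ..)

end CompRight

/-- An elementary 3-cell is obtained from its generator by the four whiskerings. A property stable
under these whiskerings therefore need only be checked on generators. -/
theorem single_eq_whisker (w : P.Whisker3) :
    FreeCell.single _ _ w =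
      rw1 (lw1 w.lam (rw0 (lw0 w.l (genCell3 w.gen) (by simp [w.hl])) w.r (by simp [w.hr]))
        (by simp [w.hlam])) w.rho (by simp [← w.hrho]) := by
  refine FreeCell.ext (by simp [Whisker3.src]) (List.ext_getElem (by simp [genCell3]) ?_)
  intro i _ _
  apply Whisker3.ext <;> simp [genCell3]

end Prepolygraph3

/-! ### 3-cells modulo the 4-generators -/

namespace GrayPresentation

open Prepolygraph2 (genCell2)
open Prepolygraph2.Cell2 (lw rw)
open Prepolygraph3
open Prepolygraph3.Cell3 (lw0 rw0 lw1 rw1)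

attribute [local simp] src_interchange tgt_interchange

variable (P : GrayPresentation.{u})

/-- Equality of 3-cells in the presented 3-precategory. -/
def Equiv (F G : P.Cell3) : Prop :=
  Precategory3.Cong P.free (fun F G => ∃ Γ : P.P4, P.s3 Γ = F ∧ P.t3 Γ = G) F G

variable {P}

namespace Equiv

theorem of_gen (Γ : P.P4) : P.Equiv (P.s3 Γ) (P.t3 Γ) := Precategory3.Cong.of ⟨Γ, rfl, rfl⟩

theorem refl (F : P.Cell3) : P.Equiv F F := Precategory3.Cong.refl _

theorem of_eq {F G : P.Cell3} (h : F = G) : P.Equiv F G := h ▸ refl F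

theorem trans {F G H : P.Cell3} (h : P.Equiv F G) (h' : P.Equiv G H) : P.Equiv F H :=
  Precategory3.Cong.trans h h'

theorem symm {F G : P.Cell3} (h : P.Equiv F G) : P.Equiv G F := Precategory3.Cong.symm h

/-- Each 4-generator relates parallel 3-cells, and the congruence preserves this. It supplies the
composability proofs in the stability lemmas that follow. -/
theorem src_eq_and_tgt_eq {F G : P.Cell3} (h : P.Equiv F G) : F.src = G.src ∧ F.tgt = G.tgt :=
  Precategory3.Cong.parallel (C := P.free) (by
    rintro _ _ ⟨Γ, rfl, rfl⟩
    exact ⟨(P.src_t3 Γ).symm, (P.tgt_t3 Γ).symm⟩) h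

theorem comp {F F' G G' : P.Cell3} (e : P.Equiv F F') (e' : P.Equiv G G') (h) :
    P.Equiv (F.comp G h) (F'.comp G' (by
      rw [← e.src_eq_and_tgt_eq.2, ← e'.src_eq_and_tgt_eq.1, h])) :=
  Precategory3.Cong.c33 (C := P.free) h (by
    show F'.tgt = G'.src
    rw [← e.src_eq_and_tgt_eq.2, ← e'.src_eq_and_tgt_eq.1, h]) e e'

theorem lw0 (f : P.Cell1) {F G : P.Cell3} (e : P.Equiv F G) (h) :
    P.Equiv (lw0 f F h) (Cell3.lw0 f G (by rw [← e.src_eq_and_tgt_eq.1, h])) :=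
  Precategory3.Cong.c13 (C := P.free) f h _ e

theorem rw0 {F G : P.Cell3} (e : P.Equiv F G) (f : P.Cell1) (h) :
    P.Equiv (rw0 F f h) (Cell3.rw0 G f (by rw [← e.src_eq_and_tgt_eq.1, h])) :=
  Precategory3.Cong.c31 (C := P.free) f h _ e

theorem lw1 (φ : P.Cell2) {F G : P.Cell3} (e : P.Equiv F G) (h) :
    P.Equiv (lw1 φ F h) (Cell3.lw1 φ G (by rw [← e.src_eq_and_tgt_eq.1, h])) :=
  Precategory3.Cong.c23 (C := P.free) φ h _ e

theorem rw1 {F G : P.Cell3} (e : P.Equiv F G) (φ : P.Cell2) (h) :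
    P.Equiv (rw1 F φ h) (Cell3.rw1 G φ (by rw [← e.src_eq_and_tgt_eq.1, h])) :=
  Precategory3.Cong.c32 (C := P.free) φ h _ e

end Equiv

/-! #### The exchange law -/

/-- The exchange law for the 3-cells `A` and `B`. -/
def Exchange (A B : P.Cell3) : Prop := ∀ h : A.src.tgt = B.src.src,
  P.Equiv (FreeCell.comp (rw1 A B.src h) (lw1 A.tgt B (by simpa using h)) (by simp))
    (FreeCell.comp (lw1 A.src B h) (rw1 A B.tgt (by simpa using h)) (by simp))

theorem exchange_nil_left (φ : P.Cell2) (B : P.Cell3) : Exchange (FreeCell.nil _ _ φ) B :=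
  fun _ => .of_eq (by simp)

theorem exchange_nil_right (A : P.Cell3) (ψ : P.Cell2) : Exchange A (FreeCell.nil _ _ ψ) :=
  fun _ => .of_eq (by simp)

/-- Two commuting squares are pasted along their common side: `B` is first moved before `A'`, then
before `A`. -/
theorem Exchange.comp_left {A A' B : P.Cell3} (e : Exchange A B) (e' : Exchange A' B) (h) :
    Exchange (A.comp A' h) B := by
  intro h₁
  replace h₁ : A.src.tgt = B.src.src := h₁
  have h₂ : A'.src.tgt = B.src.src := by simpa [← h] using h₁
  have e₁ := (Equiv.refl (rw1 A B.src h₁)).comp (e' h₂) (by simp [h])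
  have e₂ := (e h₁).comp (.refl (rw1 A' B.tgt (by simpa using h₂))) (by simp [h])
  refine (Equiv.of_eq ?_).trans (e₁.trans ((Equiv.of_eq ?_).trans (e₂.trans (.of_eq ?_)))) <;>
    simp [h]

theorem Exchange.comp_right {A B B' : P.Cell3} (e : Exchange A B) (e' : Exchange A B') (h) :
    Exchange A (B.comp B' h) := by
  intro h₁
  replace h₁ : A.src.tgt = B.src.src := h₁
  have h₂ : A.src.tgt = B'.src.src := by simpa [← h] using h₁
  have e₁ := (e h₁).comp (.refl (lw1 A.tgt B' (by simpa using h₂))) (by simp [h])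
  have e₂ := (Equiv.refl (lw1 A.src B h₁)).comp (e' h₂) (by simp [h])
  refine (Equiv.of_eq ?_).trans (e₁.trans ((Equiv.of_eq ?_).trans (e₂.trans (.of_eq ?_)))) <;>
    simp [h]

theorem exchange_single (v w : P.Whisker3) :
    Exchange (FreeCell.single _ _ v : P.Cell3) (FreeCell.single _ _ w) := by
  intro h
  -- The connecting 2-cell is everything between the two 3-generators: what follows the first in
  -- `v`, then what precedes the second in `w`. The outer contexts `v.lam` and `w.rho` are restored
  -- afterwards by whiskering.
  let c : IndependenceConfig P.toPrepolygraph3 :=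
    { A := v.gen
      B := w.gen
      e := v.l
      h := v.r
      e' := w.l
      h' := w.r
      χ := v.rho.comp w.lam (by simpa using h)
      tgt_e := v.hl
      src_h := v.hr
      tgt_eB := w.hl
      src_hB := w.hr
      src_χ := v.hrho
      tgt_χ := by simpa using w.hlam }
  have e := Equiv.of_gen (P.independence c)
  rw [P.s3_independence, P.t3_independence] at e
  have e := (e.rw1 w.rho (by
    simp [c, IndependenceConfig.Γ, IndependenceConfig.ψ, ← w.hrho])).lw1 v.lam (by
    simp [c, IndependenceConfig.Γ, IndependenceConfig.φ, v.hlam])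
  simp only [single_eq_whisker]
  refine ((Equiv.of_eq ?_).trans e).trans (.of_eq ?_) <;>
  · simp [c, IndependenceConfig.Γ, IndependenceConfig.Δ, IndependenceConfig.cellA,
      IndependenceConfig.cellB, IndependenceConfig.φ, IndependenceConfig.φ',
      IndependenceConfig.ψ, IndependenceConfig.ψ']

theorem exchange (A B : P.Cell3) : Exchange A B := by
  induction A using FreeCell.cons_induction with
  | nil φ => exact exchange_nil_left φ B
  | cons v A h ih =>
    -- What remains is the single whisker `v` against `B`, treated by a second induction.
    refine .comp_left ?_ ih h
    clear ih
    induction B using FreeCell.cons_induction with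
    | nil ψ => exact exchange_nil_right _ ψ
    | cons w B h' ih' => exact .comp_right (exchange_single v w) ih' h'

/-- Row-by-row traversal interleaves the exchanges with `ψ` and those with `ψ'`. Peeling off the
first whisker `w` leaves the order $X_{\phi,\psi}$, $X_{\phi,\psi'}$, $X_{w,\psi}$, $X_{w,\psi'}$
(contexts omitted). The two middle cells act on disjoint parts of the 2-cell, and swapping them
groups the exchanges by columns. -/
theorem interchange_comp_right (φ ψ ψ' : P.Cell2) (h : ψ.tgt = ψ'.src)
    (h₁ : φ.src.tgt = ψ.src.src) (h₂ : φ.src.tgt = ψ'.src.src) :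
    P.Equiv (interchange P.X φ (ψ.comp ψ' h) (by simpa using h₁))
      (FreeCell.comp (rw1 (interchange P.X φ ψ h₁) (lw φ.tgt ψ' (by simpa using h₂)) (by simp [h]))
        (lw1 (lw φ.src ψ h₁) (interchange P.X φ ψ' h₂) (by simp [h])) (by simp [h])) := by
  induction φ using FreeCell.cons_induction with
  | nil f =>
    replace h₁ : f.tgt = ψ.src.src := h₁
    replace h₂ : f.tgt = ψ'.src.src := h₂
    exact .of_eq (by simp [interchange_nil_left])
  | cons w φ hw ih =>
    replace h₁ : (FreeCell.single _ _ w : P.Cell2).src.tgt = ψ.src.src := h₁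
    replace h₂ : (FreeCell.single _ _ w : P.Cell2).src.tgt = ψ'.src.src := h₂
    have h₃ : φ.src.tgt = ψ.src.src := by simpa [← hw] using h₁
    have h₄ : φ.src.tgt = ψ'.src.src := by simpa [← hw] using h₂
    have e₁ := ((ih h₃ h₄).lw1 (rw (FreeCell.single _ _ w) ψ.src h₁) (by simp [← hw])).comp
      ((Equiv.of_eq (interchange_single_comp P.X w ψ ψ' h h₁ h₂ (by simpa using h₁))).rw1
        (rw φ ψ'.tgt (by simpa using h₄)) (by simp [← hw])) (by simp [← hw])
    -- At this stage the 2-cells occur in the order `w`, `ψ`, `φ`, `ψ'`: the first pair and the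
    -- second pair are exchanged independently.
    have e₂ := (exchange (interchange P.X (FreeCell.single _ _ w) ψ h₁) (interchange P.X φ ψ' h₄)
      (by simp [h, ← hw])).symm
    have e₃ := ((Equiv.refl (lw1 (rw (FreeCell.single _ _ w) ψ.src h₁)
      (rw1 (interchange P.X φ ψ h₃) (lw φ.tgt ψ' (by simpa using h₄)) (by simp [h]))
      (by simp [← hw]))).comp (e₂.comp (.refl (lw1 (lw w.src ψ (by simpa using h₁))
        (rw1 (interchange P.X (FreeCell.single _ _ w) ψ' h₂) (rw φ ψ'.tgt (by simpa using h₄))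
        (by simp [← hw])) (by simp [h]))) (by simp [h, ← hw])) (by simp [h, ← hw]))
    refine (Equiv.of_eq ?_).trans (e₁.trans ((Equiv.of_eq ?_).trans (e₃.trans (.of_eq ?_))))
    · exact (interchange_comp_left P.X _ φ _ hw (by simpa using h₁) (by simpa using h₃) _).trans
        (by simp)
    · simp [← hw]
    · have c := interchange_comp_left P.X _ φ ψ hw h₁ h₃ (by simpa using h₁)
      have c' := interchange_comp_left P.X _ φ ψ' hw h₂ h₄ (by simpa using h₂)
      simp [h, c, c']

/-! #### Naturality of the interchange cells in the first variable -/

/-- Naturality of the interchange cells for the 3-cell `A` and the 2-cell `ψ`. -/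
def NaturalLeft (A : P.Cell3) (ψ : P.Cell2) : Prop := ∀ h : A.src.src.tgt = ψ.src.src,
  P.Equiv (FreeCell.comp (rw1 (rw0 A ψ.src h) (lw A.src.tgt ψ (by simpa using h)) (by simp))
      (interchange P.X A.tgt ψ (by simpa using h)) (by simp))
    (FreeCell.comp (interchange P.X A.src ψ h)
      (lw1 (lw A.src.src ψ h) (rw0 A ψ.tgt (by simpa using h)) (by simp)) (by simp))

theorem naturalLeft_nil_left (φ : P.Cell2) (ψ : P.Cell2) :
    NaturalLeft (FreeCell.nil _ _ φ) ψ := by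
  intro h
  replace h : φ.src.tgt = ψ.src.src := h
  exact .of_eq (by simp)

theorem naturalLeft_nil_right (A : P.Cell3) (g : P.Cell1) :
    NaturalLeft A (FreeCell.nil _ _ g) := by
  intro h
  replace h : A.src.src.tgt = g.src := h
  exact .of_eq (by simp [interchange_nil_right])

theorem NaturalLeft.comp_left {A A' : P.Cell3} {ψ : P.Cell2} (e : NaturalLeft A ψ)
    (e' : NaturalLeft A' ψ) (h) : NaturalLeft (A.comp A' h) ψ := by
  intro h₁
  replace h₁ : A.src.src.tgt = ψ.src.src := h₁
  have h₂ : A'.src.src.tgt = ψ.src.src := by simpa [← h] using h₁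
  have e₁ := (Equiv.refl (rw1 (rw0 A ψ.src h₁) (lw A.src.tgt ψ (by simpa using h₁))
    (by simp))).comp (e' h₂) (by simp [← h])
  have e₂ := (e h₁).comp (.refl (lw1 (lw A'.src.src ψ h₂) (rw0 A' ψ.tgt (by simpa using h₂))
    (by simp))) (by simp [← h])
  refine (Equiv.of_eq ?_).trans (e₁.trans ((Equiv.of_eq ?_).trans (e₂.trans (.of_eq ?_)))) <;>
    simp [← h]

/-- The interchanger with $\psi\circ_1\psi'$ is split modulo the congruence, `A` is carried across
the two pieces in turn, and the pieces are recombined. -/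
theorem NaturalLeft.comp_right {A : P.Cell3} {ψ ψ' : P.Cell2} (e : NaturalLeft A ψ)
    (e' : NaturalLeft A ψ') (h) : NaturalLeft A (ψ.comp ψ' h) := by
  intro h₁
  replace h₁ : A.src.src.tgt = ψ.src.src := h₁
  have h₂ : A.src.src.tgt = ψ'.src.src := by
    simpa using h₁.trans (by simpa using congrArg FreeCell.src h)
  have e₀ := (Equiv.refl (rw1 (rw0 A ψ.src h₁)
    (lw A.src.tgt (ψ.comp ψ' h) (by simpa using h₁)) (by simp))).comp
    (interchange_comp_right A.tgt ψ ψ' h (by simpa using h₁) (by simpa using h₂)) (by simp)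
  have e₁ := ((e h₁).rw1 (lw A.src.tgt ψ' (by simpa using h₂)) (by simp [h])).comp
    (.refl (lw1 (lw A.src.src ψ h₁) (interchange P.X A.tgt ψ' (by simpa using h₂))
      (by simp [h]))) (by simp [h])
  have e₂ := (Equiv.refl (rw1 (interchange P.X A.src ψ h₁) (lw A.src.tgt ψ' (by simpa using h₂))
      (by simp [h]))).comp ((e' h₂).lw1 (lw A.src.src ψ h₁) (by simp [h])) (by simp [h])
  have e₃ := (interchange_comp_right A.src ψ ψ' h h₁ h₂).symm.comp
    (.refl (lw1 (lw A.src.src (ψ.comp ψ' h) (by simpa using h₁)) (rw0 A ψ'.tgt (by simpa using h₂))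
      (by simp))) (by simp)
  refine (Equiv.of_eq ?_).trans (e₀.trans ((Equiv.of_eq ?_).trans (e₁.trans ((Equiv.of_eq ?_).trans
    (e₂.trans ((Equiv.of_eq ?_).trans (e₃.trans (.of_eq ?_)))))))) <;>
    simp [h]

/-- After `ψ` has crossed the source of `A`, it still has to cross `φ`. That crossing happens before
the place where `A` acts, so the exchange law commutes the two. -/
theorem NaturalLeft.lw1 {A : P.Cell3} {ψ : P.Cell2} (e : NaturalLeft A ψ) (φ : P.Cell2) (h) :
    NaturalLeft (lw1 φ A h) ψ := by
  intro h₁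
  replace h₁ : φ.src.tgt = ψ.src.src := by simpa using h₁
  have h₂ : A.src.src.tgt = ψ.src.src := by simpa [← h] using h₁
  have e₁ := ((e h₂).lw1 (rw φ ψ.src h₁) (by simp [h])).comp
    (.refl (rw1 (interchange P.X φ ψ h₁) (rw A.tgt ψ.tgt (by simpa using h₂)) (by simp [h])))
    (by simp [h])
  have e₂ := (Equiv.refl (Cell3.lw1 (rw φ ψ.src h₁) (interchange P.X A.src ψ h₂) (by simp [h]))).comp
    (exchange (interchange P.X φ ψ h₁) (rw0 A ψ.tgt (by simpa using h₂)) (by simp [h])).symm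
    (by simp [h])
  have c := interchange_comp_left P.X φ A.tgt ψ (by simp [h]) h₁ (by simpa using h₂)
    (by simpa using h₁)
  have c' := interchange_comp_left P.X φ A.src ψ h h₁ h₂ (by simpa using h₁)
  refine (Equiv.of_eq ?_).trans (e₁.trans ((Equiv.of_eq ?_).trans (e₂.trans (.of_eq ?_)))) <;>
    simp [h, c, c']

/-- Here `φ` crosses `ψ` first, after the place where `A` acts. The exchange law postpones `A`, and
then naturality for `A` applies. -/
theorem NaturalLeft.rw1 {A : P.Cell3} {ψ : P.Cell2} (e : NaturalLeft A ψ) (φ : P.Cell2) (h) :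
    NaturalLeft (rw1 A φ h) ψ := by
  intro h₁
  replace h₁ : A.src.src.tgt = ψ.src.src := by simpa using h₁
  have h₂ : φ.src.tgt = ψ.src.src := by simpa [← h] using h₁
  have e₁ := (exchange (rw0 A ψ.src h₁) (interchange P.X φ ψ h₂) (by simp [h])).comp
    (.refl (Cell3.rw1 (interchange P.X A.tgt ψ (by simpa using h₁)) (rw φ ψ.tgt (by simpa using h₂))
      (by simp [h]))) (by simp [h])
  have e₂ := (Equiv.refl (Cell3.lw1 (rw A.src ψ.src h₁) (interchange P.X φ ψ h₂) (by simp [h]))).comp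
    ((e h₁).rw1 (rw φ ψ.tgt (by simpa using h₂)) (by simp [h])) (by simp [h])
  have c := interchange_comp_left P.X A.tgt φ ψ (by simp [h]) (by simpa using h₁) h₂
    (by simpa using h₁)
  have c' := interchange_comp_left P.X A.src φ ψ h h₁ h₂ (by simpa using h₁)
  refine (Equiv.of_eq ?_).trans (e₁.trans ((Equiv.of_eq ?_).trans (e₂.trans (.of_eq ?_)))) <;>
    simp [h, c, c']

theorem NaturalLeft.lw0 {A : P.Cell3} {ψ : P.Cell2} (e : NaturalLeft A ψ) (f : P.Cell1) (h) :
    NaturalLeft (lw0 f A h) ψ := by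
  intro h₁
  replace h₁ : A.src.src.tgt = ψ.src.src := by simpa using h₁
  have e₁ := (e h₁).lw0 f (by simpa using h)
  have c := interchange_lw P.X f A.tgt ψ (by simpa using h) (by simpa using h₁) (by simpa using h₁)
    (by simpa using h)
  have c' := interchange_lw P.X f A.src ψ h h₁ (by simpa using h₁) (by simpa using h)
  refine (Equiv.of_eq ?_).trans (e₁.trans (.of_eq ?_)) <;> simp [c, c']

/-- A 1-cell between `A` and `ψ` cannot be discarded, only passed to the other side by
`interchange_middle`. The hypothesis therefore concerns the whiskered 2-cell. -/
theorem NaturalLeft.rw0 {A : P.Cell3} {ψ : P.Cell2} (f : P.Cell1) (h) (h')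
    (e : NaturalLeft A (lw f ψ h')) : NaturalLeft (rw0 A f h) ψ := by
  intro h₁
  have e₁ := e (by simpa using h)
  have c := interchange_middle P.X A.tgt f ψ (by simpa using h) h' (by simpa using h')
    (by simpa using h)
  have c' := interchange_middle P.X A.src f ψ h h' (by simpa using h') (by simpa using h)
  refine (Equiv.of_eq ?_).trans (e₁.trans (.of_eq ?_)) <;> simp [c, c']

theorem NaturalLeft.rw {A : P.Cell3} {ψ : P.Cell2} (e : NaturalLeft A ψ) (f : P.Cell1) (h) :
    NaturalLeft A (rw ψ f h) := by
  intro h₁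
  replace h₁ : A.src.src.tgt = ψ.src.src := by simpa using h₁
  have e₁ := (e h₁).rw0 f (by simpa using h)
  have c := interchange_rw P.X A.tgt ψ f (by simpa using h₁) h (by simpa using h₁)
    (by simpa using h)
  have c' := interchange_rw P.X A.src ψ f h₁ h (by simpa using h₁) (by simpa using h)
  refine (Equiv.of_eq ?_).trans (e₁.trans (.of_eq ?_)) <;> simp [c, c']

theorem naturalLeft_gen (A : P.P3) (g : P.Cell1) (β : P.P2) (h) :
    NaturalLeft (genCell3 A) (lw g (genCell2 β) h : P.Cell2) := by
  intro h₁
  let c : NaturalityConfigLeft P.toPrepolygraph3 :=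
    { A := A
      g := g
      β := β
      src_g := by simpa using h₁
      tgt_g := by simpa using h }
  have e := Equiv.of_gen (P.naturalityLeft c)
  rw [P.s3_naturalityLeft, P.t3_naturalityLeft] at e
  refine ((Equiv.of_eq ?_).trans e).trans (.of_eq ?_) <;>
  · simp [c, NaturalityConfigLeft.Γ, NaturalityConfigLeft.Δ, NaturalityConfigLeft.ψ]

theorem naturalLeft_single (v : P.Whisker3) (w : P.Whisker2) :
    NaturalLeft (FreeCell.single _ _ v : P.Cell3) (FreeCell.single _ _ w : P.Cell2) := by
  intro h
  have hr : v.r.tgt = w.l.src := by simpa [v.lam_src_tgt] using h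
  revert h
  rw [single_eq_whisker]
  -- The 2-cell contexts and the left 1-cell of `v` are removed, while its right 1-cell is handed to
  -- `w`; composed with `w.l`, it becomes the middle 1-cell of the 4-generator. The factor `w.r`,
  -- absent from that generator, comes from `NaturalLeft.rw`.
  refine NaturalLeft.rw1 (.lw1 (.rw0 _ _ (by simpa using hr) (.lw0 ?_ _ _)) _ _) _ _
  have := (naturalLeft_gen v.gen (v.r.comp w.l hr) w.gen (by simp [w.hl])).rw w.r (by simp [w.hr])
  simpa [single_eq] using this

theorem naturalLeft (A : P.Cell3) (ψ : P.Cell2) : NaturalLeft A ψ := by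
  induction ψ using FreeCell.cons_induction with
  | nil g => exact naturalLeft_nil_right A g
  | cons w ψ h ih =>
    refine .comp_right ?_ ih h
    clear ih
    induction A using FreeCell.cons_induction with
    | nil φ => exact naturalLeft_nil_left φ _
    | cons v A h' ih' => exact .comp_left (naturalLeft_single v w) ih' h'

/-! #### Naturality of the interchange cells in the second variable -/

/-- Naturality of the interchange cells for the 2-cell `φ` and the 3-cell `B`. -/
def NaturalRight (φ : P.Cell2) (B : P.Cell3) : Prop := ∀ h : φ.src.tgt = B.src.src.src,
  P.Equiv (FreeCell.comp (lw1 (rw φ B.src.src h) (lw0 φ.tgt B (by simpa using h)) (by simp))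
      (interchange P.X φ B.tgt (by simpa using h)) (by simp))
    (FreeCell.comp (interchange P.X φ B.src h)
      (rw1 (lw0 φ.src B h) (rw φ B.src.tgt (by simpa using h)) (by simp)) (by simp))

theorem naturalRight_nil_left (f : P.Cell1) (B : P.Cell3) :
    NaturalRight (FreeCell.nil _ _ f) B := by
  intro h
  replace h : f.tgt = B.src.src.src := h
  exact .of_eq (by simp [interchange_nil_left])

theorem naturalRight_nil_right (φ ψ : P.Cell2) : NaturalRight φ (FreeCell.nil _ _ ψ) := by
  intro h
  replace h : φ.src.tgt = ψ.src.src := h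
  exact .of_eq (by simp)

theorem NaturalRight.comp_right {φ : P.Cell2} {B B' : P.Cell3} (e : NaturalRight φ B)
    (e' : NaturalRight φ B') (h) : NaturalRight φ (B.comp B' h) := by
  intro h₁
  replace h₁ : φ.src.tgt = B.src.src.src := h₁
  have h₂ : φ.src.tgt = B'.src.src.src := by simpa [← h] using h₁
  have e₁ := (Equiv.refl (lw1 (rw φ B.src.src h₁) (lw0 φ.tgt B (by simpa using h₁))
    (by simp))).comp (e' h₂) (by simp [← h])
  have e₂ := (e h₁).comp (.refl (rw1 (lw0 φ.src B' h₂) (rw φ B'.src.tgt (by simpa using h₂))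
    (by simp))) (by simp [← h])
  refine (Equiv.of_eq ?_).trans (e₁.trans ((Equiv.of_eq ?_).trans (e₂.trans (.of_eq ?_)))) <;>
    simp [← h]

/-- The first variable splits strictly, so two commuting squares suffice, with `φ'` crossing `B`
before `φ` does. -/
theorem NaturalRight.comp_left {φ φ' : P.Cell2} {B : P.Cell3} (e : NaturalRight φ B)
    (e' : NaturalRight φ' B) (h) : NaturalRight (φ.comp φ' h) B := by
  intro h₁
  replace h₁ : φ.src.tgt = B.src.src.src := h₁
  have h₂ : φ'.src.tgt = B.src.src.src := by simpa [← h] using h₁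
  have e₁ := ((e' h₂).lw1 (rw φ B.src.src h₁) (by simp [h])).comp
    (.refl (rw1 (interchange P.X φ B.tgt (by simpa using h₁)) (rw φ' B.src.tgt (by simpa using h₂))
      (by simp [h]))) (by simp [h])
  have e₂ := (Equiv.refl (lw1 (rw φ B.src.src h₁) (interchange P.X φ' B.src h₂)
    (by simp [h]))).comp ((e h₁).rw1 (rw φ' B.src.tgt (by simpa using h₂)) (by simp [h]))
    (by simp [h])
  have c := interchange_comp_left P.X φ φ' B.tgt h (by simpa using h₁) (by simpa using h₂)
    (by simpa using h₁)
  have c' := interchange_comp_left P.X φ φ' B.src h h₁ h₂ (by simpa using h₁)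
  refine (Equiv.of_eq ?_).trans (e₁.trans ((Equiv.of_eq ?_).trans (e₂.trans (.of_eq ?_)))) <;>
    simp [h, c, c']

/-- The crossing of `φ` with `ψ` takes place before the position of `B`, and the exchange law
performs it first. In contrast to `NaturalLeft.lw1`, the composite now sits in the second variable,
so splitting and recombining the interchangers also use the congruence. -/
theorem NaturalRight.lw1 {φ : P.Cell2} {B : P.Cell3} (e : NaturalRight φ B) (ψ : P.Cell2) (h) :
    NaturalRight φ (lw1 ψ B h) := by
  intro h₁
  replace h₁ : φ.src.tgt = ψ.src.src := by simpa using h₁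
  have h₂ : φ.src.tgt = B.src.src.src := by simpa [← h] using h₁
  have e₀ := (Equiv.refl (Cell3.lw1 (FreeCell.comp (rw φ ψ.src h₁) (lw φ.tgt ψ (by simpa using h₁))
    (by simp)) (lw0 φ.tgt B (by simpa using h₂)) (by simp [h]))).comp
    (interchange_comp_right φ ψ B.tgt (by simp [h]) h₁ (by simpa using h₂)) (by simp)
  have e₁ := (exchange (interchange P.X φ ψ h₁) (lw0 φ.tgt B (by simpa using h₂))
    (by simp [h])).symm.comp (.refl (Cell3.lw1 (lw φ.src ψ h₁)
      (interchange P.X φ B.tgt (by simpa using h₂)) (by simp [h]))) (by simp [h])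
  have e₂ := (Equiv.refl (Cell3.rw1 (interchange P.X φ ψ h₁) (lw φ.tgt B.src (by simpa using h₂))
    (by simp [h]))).comp ((e h₂).lw1 (lw φ.src ψ h₁) (by simp [h])) (by simp [h])
  have e₃ := (interchange_comp_right φ ψ B.src h h₁ h₂).symm.comp
    (.refl (Cell3.rw1 (Cell3.lw1 (lw φ.src ψ h₁) (lw0 φ.src B h₂) (by simp [h]))
      (rw φ B.src.tgt (by simpa using h₂)) (by simp))) (by simp)
  refine (Equiv.of_eq ?_).trans (e₀.trans ((Equiv.of_eq ?_).trans (e₁.trans ((Equiv.of_eq ?_).trans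
    (e₂.trans ((Equiv.of_eq ?_).trans (e₃.trans (.of_eq ?_)))))))) <;>
    simp [h]

/-- Once `φ` has crossed the source of `B`, its crossing with `ψ` takes place after the position of
`B`, so the exchange law commutes the two. -/
theorem NaturalRight.rw1 {φ : P.Cell2} {B : P.Cell3} (e : NaturalRight φ B) (ψ : P.Cell2) (h) :
    NaturalRight φ (rw1 B ψ h) := by
  intro h₁
  replace h₁ : φ.src.tgt = B.src.src.src := by simpa using h₁
  have h₂ : φ.src.tgt = ψ.src.src := by simpa [← h] using h₁
  have e₀ := (Equiv.refl (Cell3.lw1 (rw φ B.src.src h₁)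
    (Cell3.rw1 (lw0 φ.tgt B (by simpa using h₁)) (lw φ.tgt ψ (by simpa using h₂)) (by simp [h]))
    (by simp))).comp
    (interchange_comp_right φ B.tgt ψ (by simp [h]) (by simpa using h₁) h₂) (by simp)
  have e₁ := ((e h₁).rw1 (lw φ.tgt ψ (by simpa using h₂)) (by simp [h])).comp
    (.refl (Cell3.lw1 (lw φ.src B.tgt (by simpa using h₁)) (interchange P.X φ ψ h₂)
      (by simp [h]))) (by simp [h])
  have e₂ := (Equiv.refl (Cell3.rw1 (interchange P.X φ B.src h₁) (lw φ.tgt ψ (by simpa using h₂))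
    (by simp [h]))).comp (exchange (lw0 φ.src B h₁) (interchange P.X φ ψ h₂) (by simp [h]))
    (by simp [h])
  have e₃ := (interchange_comp_right φ B.src ψ h h₁ h₂).symm.comp
    (.refl (Cell3.rw1 (lw0 φ.src B h₁) (FreeCell.comp (lw φ.src ψ h₂)
      (rw φ ψ.tgt (by simpa using h₂)) (by simp)) (by simp [h]))) (by simp)
  refine (Equiv.of_eq ?_).trans (e₀.trans ((Equiv.of_eq ?_).trans (e₁.trans ((Equiv.of_eq ?_).trans
    (e₂.trans ((Equiv.of_eq ?_).trans (e₃.trans (.of_eq ?_)))))))) <;>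
    simp [h]

theorem NaturalRight.rw0 {φ : P.Cell2} {B : P.Cell3} (e : NaturalRight φ B) (f : P.Cell1) (h) :
    NaturalRight φ (rw0 B f h) := by
  intro h₁
  replace h₁ : φ.src.tgt = B.src.src.src := by simpa using h₁
  have e₁ := (e h₁).rw0 f (by simpa using h)
  have c := interchange_rw P.X φ B.tgt f (by simpa using h₁) (by simpa using h) (by simpa using h₁)
    (by simpa using h)
  have c' := interchange_rw P.X φ B.src f h₁ h (by simpa using h₁) (by simpa using h)
  refine (Equiv.of_eq ?_).trans (e₁.trans (.of_eq ?_)) <;> simp [c, c']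

theorem NaturalRight.lw0 {φ : P.Cell2} {B : P.Cell3} (f : P.Cell1) (h) (h')
    (e : NaturalRight (rw φ f h') B) : NaturalRight φ (lw0 f B h) := by
  intro h₁
  have e₁ := e (by simpa using h)
  have c := interchange_middle P.X φ f B.tgt h' (by simpa using h) (by simpa using h)
    (by simpa using h')
  have c' := interchange_middle P.X φ f B.src h' h (by simpa using h) (by simpa using h')
  refine (Equiv.of_eq ?_).trans (e₁.trans (.of_eq ?_)) <;> simp [c, c']

theorem NaturalRight.lw {φ : P.Cell2} {B : P.Cell3} (e : NaturalRight φ B) (f : P.Cell1) (h) :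
    NaturalRight (lw f φ h) B := by
  intro h₁
  replace h₁ : φ.src.tgt = B.src.src.src := by simpa using h₁
  have e₁ := (e h₁).lw0 f (by simpa using h)
  have c := interchange_lw P.X f φ B.tgt h (by simpa using h₁) (by simpa using h₁)
    (by simpa using h)
  have c' := interchange_lw P.X f φ B.src h h₁ (by simpa using h₁) (by simpa using h)
  refine (Equiv.of_eq ?_).trans (e₁.trans (.of_eq ?_)) <;> simp [c, c']

theorem naturalRight_gen (α : P.P2) (g : P.Cell1) (B : P.P3) (h) :
    NaturalRight (rw (genCell2 α) g h : P.Cell2) (genCell3 B) := by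
  intro h₁
  let c : NaturalityConfigRight P.toPrepolygraph3 :=
    { α := α
      g := g
      B := B
      src_g := by simpa using h
      tgt_g := by simpa using h₁ }
  have e := Equiv.of_gen (P.naturalityRight c)
  rw [P.s3_naturalityRight, P.t3_naturalityRight] at e
  refine ((Equiv.of_eq ?_).trans e).trans (.of_eq ?_) <;>
  · simp [c, NaturalityConfigRight.Γ, NaturalityConfigRight.Δ, NaturalityConfigRight.φ]

theorem naturalRight_single (v : P.Whisker2) (w : P.Whisker3) :
    NaturalRight (FreeCell.single _ _ v : P.Cell2) (FreeCell.single _ _ w : P.Cell3) := by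
  intro h
  have hr : v.r.tgt = w.l.src := by simpa [w.lam_src_src] using h
  revert h
  rw [single_eq_whisker]
  -- This time the left 1-cell of `w` is handed to `v`, and `v.l` is what the 4-generator lacks;
  -- `NaturalRight.lw` supplies it.
  refine NaturalRight.rw1 (.lw1 (.rw0 (.lw0 _ _ (by simpa using hr) ?_) _ _) _ _) _ _
  have := (naturalRight_gen v.gen (v.r.comp w.l hr) w.gen (by simp [v.hr])).lw v.l
    (by simp [v.hl])
  simpa [single_eq] using this

theorem naturalRight (φ : P.Cell2) (B : P.Cell3) : NaturalRight φ B := by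
  induction φ using FreeCell.cons_induction with
  | nil f => exact naturalRight_nil_left f B
  | cons v φ h ih =>
    refine .comp_left ?_ ih h
    clear ih
    induction B using FreeCell.cons_induction with
    | nil ψ => exact naturalRight_nil_right _ ψ
    | cons w B h' ih' => exact .comp_right (naturalRight_single v w) ih' h'

end GrayPresentation
end GrayRewriting

/-! ### The lax Gray axioms in the presented 3-precategory -/

theorem mainTheorem4 (P : GrayRewriting.GrayPresentation.{u}) :
    GrayRewriting.IsLaxGray P.presented P.interchanger := by
  open GrayRewriting GrayRewriting.GrayPresentation GrayRewriting.Prepolygraph3 in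
  exact
  { X_id_left := fun f ψ h => congrArg (Precategory3.qmk _) (interchange_nil_left P.X f ψ h)
    X_id_right := fun φ g h => congrArg (Precategory3.qmk _) (interchange_nil_right P.X φ g h)
    X_comp_left := fun φ φ' ψ h h' => congrArg (Precategory3.qmk _)
      (interchange_comp_left P.X φ φ' ψ h h' 
        ((congrArg FreeCell.tgt h).symm.trans ((Prepolygraph2.Cell2.tgt_tgt_eq φ).trans h')) _)
    -- Of the interchanger axioms, this one alone is obtained from the congruence; the others are
    -- images of equalities in $P^*$.
    X_comp_right := fun φ ψ ψ' h h' => Quotient.sound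
      (GrayPresentation.interchange_comp_right φ ψ ψ' h h'
        (Eq.trans h' ((Prepolygraph2.Cell2.src_tgt_eq ψ).symm.trans (congrArg FreeCell.src h))))
    X_whisker_left := fun e φ ψ h h' => congrArg (Precategory3.qmk _)
      (interchange_lw P.X e φ ψ h h' _ _)
    X_whisker_right := fun φ ψ k h h' => congrArg (Precategory3.qmk _)
      (interchange_rw P.X φ ψ k h h' _ _)
    X_whisker_middle := fun φ f ψ h h' => congrArg (Precategory3.qmk _)
      (interchange_middle P.X φ f ψ h h' _ _)
    exchange := by
      rintro ⟨A⟩ ⟨B⟩ h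
      exact Quotient.sound (GrayPresentation.exchange A B h)
    X_natural_left := by
      rintro ⟨A⟩ ψ h
      exact Quotient.sound (naturalLeft A ψ h)
    X_natural_right := by
      rintro φ ⟨B⟩ h
      exact Quotient.sound (naturalRight φ B h) }
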